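/- For integers $d\ge 1$ and $N\ge 1$ let $\alpha=\frac{d-1}{d}$ and consider the birth-and-death process on $\{0,1,\dots,N^d\}$ with birth rates $b(0)=1$, $b(x)=x^\alpha$ for $1\le x<N^d$, $b(N^d)=0$, and death rates $d(0)=0$, $d(1)=e$, $d(x+1)=x^\alpha\exp\big((x+1)^\alpha-x^\alpha\big)$ for $x\ge 1$. It is reversible with respect to the probability measure $\mu(x)=\frac1Z e^{-x^\alpha}$ (with $0^\alpha=0$, also for $d=1$). Let $$\mathcal E(f)=\frac12\sum_{x}\mu(x)\Big[b(x)\,(f(x+1)-f(x))^2+d(x)\,(f(x-1)-f(x))^2\Big].$$ For $a\in(0,1)$ let the Beckner constant $C(a,N)$ be the best constant $C$ such that, for every function $f$, $$\sup_{p\in(1,2)}\frac{\int f^2\,d\mu-\big(\int|f|^p\,d\mu\big)^{2/p}}{(2-p)^a}\le C\,\mathcal E(f);$$ the Poincaré constant and the logarithmic Sobolev constant are the best constants in $\operatorname{Var}_\mu(f)\le C\,\mathcal E(f)$ and $\operatorname{Ent}_\mu(f^2)\le C\,\mathcal E(f)$ respectively. **Theorem.** For each $d\ge 1$ there exists a real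 number $a_d$, equal to $\frac{3\alpha-2}{\alpha}=\frac{d-3}{d-1}$ when $d\ge2$, such that: * if $a\in(0,1)$ and $a>a_d$, then $C(a,N)$ grows polynomially in $N$, like $N^{\gamma}$ with $\gamma=d(2-3\alpha+\alpha a)>0$: there is $k>0$, depending only on $d$ and $a$, such that $k^{-1}N^{\gamma}\le C(a,N)\le kN^{\gamma}$ for all $N\ge1$; * if $a\in(0,1)$ and $a<a_d$, then $C(a,N)$ stays bounded in $N$. Moreover: * if $d=1$ or $d=2$, then $a_d<0$, and all the constants (the Poincaré constant, $C(a,N)$ for every $a\in(0,1)$, and the logarithmic Sobolev constant) tend to infinity as $N\to\infty$; * if $d=3$, then $a_d=0$, the Poincaré constant stays bounded in $N$, and all the other constants ($C(a,N)$ for every $a\in(0,1)$, and the logarithmic Sobolev constant) tend to infinity as $N\to\infty$; * if $d>3$, then $a_d\in(0,1)$. -/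

import Mathlib

open Filter Topology
open scoped NNReal ENNReal

noncomputable section

namespace ToyModel

/-- The exponent `α = (d - 1) / d` attached to the dimension `d`. -/
def alpha (d : ℕ) : ℝ := ((d : ℝ) - 1) / d

/-- Birth rates on `{0, …, n}`: `b 0 = 1`, `b x = x ^ α` for `1 ≤ x < n`, and no birth at the
upper end point `n`. -/
def birthRate (d n x : ℕ) : ℝ :=
  if x < n then (if x = 0 then 1 else (x : ℝ) ^ alpha d) else 0

/-- Death rates: no death at `0`, `d 1 = e`, and
`d (y + 1) = y ^ α * exp ((y + 1) ^ α - y ^ α)` for `y ≥ 1` (below, `y = x + 1`). -/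
def deathRate (d : ℕ) : ℕ → ℝ
  | 0 => 0
  | 1 => Real.exp 1
  | x + 2 => ((x + 1 : ℕ) : ℝ) ^ alpha d *
      Real.exp (((x + 2 : ℕ) : ℝ) ^ alpha d - ((x + 1 : ℕ) : ℝ) ^ alpha d)

/-- The function `x ^ α`, with the value `0` at `x = 0` also when `α = 0` (that is, `d = 1`);
this is the convention for which the chain is reversible when `d = 1`. -/
def potential (d x : ℕ) : ℝ := if x = 0 then 0 else (x : ℝ) ^ alpha d

/-- The normalizing constant of the reversible measure on `{0, …, n}`. -/
def partitionFunction (d n : ℕ) : ℝ :=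
  ∑ x ∈ Finset.range (n + 1), Real.exp (-potential d x)

/-- The reversible probability measure `μ x = exp (-x ^ α) / Z` on `{0, …, n}`. -/
def mu (d n x : ℕ) : ℝ := Real.exp (-potential d x) / partitionFunction d n

/-- The integral `∫ g dμ`; functions on `{0, …, n}` are given as functions on `ℕ` whose values
beyond `n` play no role. -/
def mean (d n : ℕ) (g : ℕ → ℝ) : ℝ := ∑ x ∈ Finset.range (n + 1), mu d n x * g x

/-- The carré du champ `Γ(f) = (L (f ^ 2) - 2 f L f) / 2` of the chain, the discrete analogue
of `|∇ f| ^ 2`. At `x = 0` the death rate vanishes, at `x = n` the birth rate does. -/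
def gradSq (d n : ℕ) (f : ℕ → ℝ) (x : ℕ) : ℝ :=
  (birthRate d n x * (f (x + 1) - f x) ^ 2 + deathRate d x * (f (x - 1) - f x) ^ 2) / 2

/-- The energy (Dirichlet form) `∫ Γ(f) dμ`. -/
def energy (d n : ℕ) (f : ℕ → ℝ) : ℝ := mean d n (gradSq d n f)

/-- The generalized Beckner inequality of parameter `a` with constant `C` for the chain
on `{0, …, n}`. -/
def Beckner (d n : ℕ) (a C : ℝ) : Prop :=
  ∀ f : ℕ → ℝ, ∀ p ∈ Set.Ioo (1 : ℝ) 2,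
    (mean d n (fun x => f x ^ 2) - mean d n (fun x => |f x| ^ p) ^ (2 / p)) / (2 - p) ^ a
      ≤ C * energy d n f

/-- The Poincaré inequality with constant `C`. -/
def Poincare (d n : ℕ) (C : ℝ) : Prop :=
  ∀ f : ℕ → ℝ, mean d n (fun x => f x ^ 2) - mean d n f ^ 2 ≤ C * energy d n f

/-- The logarithmic Sobolev inequality with constant `C` (with `0 log 0 = 0`). -/
def LogSobolev (d n : ℕ) (C : ℝ) : Prop :=
  ∀ f : ℕ → ℝ,
    mean d n (fun x => f x ^ 2 * Real.log (f x ^ 2))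
        - mean d n (fun x => f x ^ 2) * Real.log (mean d n (fun x => f x ^ 2))
      ≤ C * energy d n f

/-- The Beckner constant `C(a, N)`: the best constant for the chain on `{0, …, N ^ d}`
(it would be `∞` if no constant were admissible). -/
def becknerConst (d : ℕ) (a : ℝ) (N : ℕ) : ℝ≥0∞ :=
  ⨅ (C : ℝ≥0) (_ : Beckner d (N ^ d) a C), (C : ℝ≥0∞)

/-- The best Poincaré constant for the chain on `{0, …, N ^ d}`. -/
def poincareConst (d N : ℕ) : ℝ≥0∞ :=
  ⨅ (C : ℝ≥0) (_ : Poincare d (N ^ d) C), (C : ℝ≥0∞)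

/-- The best logarithmic Sobolev constant for the chain on `{0, …, N ^ d}`. -/
def logSobolevConst (d N : ℕ) : ℝ≥0∞ :=
  ⨅ (C : ℝ≥0) (_ : LogSobolev d (N ^ d) C), (C : ℝ≥0∞)

/-- `c N` grows like `N ^ γ`: it lies between two positive multiples of `N ^ γ`. -/
def GrowsLike (c : ℕ → ℝ≥0∞) (γ : ℝ) : Prop :=
  ∃ k : ℝ, 0 < k ∧ ∀ N : ℕ, 1 ≤ N →
    ENNReal.ofReal (k⁻¹ * (N : ℝ) ^ γ) ≤ c N ∧ c N ≤ ENNReal.ofReal (k * (N : ℝ) ^ γ)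

/-- `c N` stays bounded in `N`. -/
def StaysBounded (c : ℕ → ℝ≥0∞) : Prop :=
  ∃ K : ℝ≥0, ∀ N : ℕ, 1 ≤ N → c N ≤ K

/-- `c N` blows up as `N → ∞`. -/
def BlowsUp (c : ℕ → ℝ≥0∞) : Prop := Tendsto c atTop (𝓝 ⊤)

end ToyModel

end

/-!
Write `n = N ^ d`, `γ = d (2 - 3 α + α a) = 3 - d + (d - 1) a` and `ε = 2 - p`. Since
`n ^ α = N ^ (d - 1)`, all the claims follow from two-sided bounds of the Beckner constant by
`N ^ γ`, from the analogous lower bounds for the two other constants, and from an upper bound for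
the Poincaré constant when `d ≥ 3`. Up to the factor `1 / Z`, the energy is the sum over edges of
`w(x) (f(x+1) - f(x))²` with conductances `w(0) = 1` and `w(x) = x ^ α exp (-x ^ α)`
for `x ≥ 1` (`energy_eq`).

*Upper bound, `d ≥ 2`.* The chain is discrete, so `f(x)² μ(x) ≤ ∫ f² dμ` at every atom. Hence
`|f|` never exceeds a multiple of `μ ^ (-1/2)`, and the Beckner gap is at most
`2 ε ^ a ∫ f² (1 - log μ) ^ a dμ` (`becknerGap_le_log`). To replace `f` by `f - f(0)`, compare
`∫ f² dμ` with `f(0)²`: if it is larger, `f` and `f - f(0)` are comparable in mean square; if it is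
not, linearize the gap around the constant `f(0)`, where it is of second order with a coefficient
of order `ε` (`remainder_le_log`, `becknerGap_le_centred`). Here `1 - log μ(x)` is comparable to
`x ^ α`, so a Hardy inequality with weight `x ^ (α a)` remains to be shown. It follows from the
supersolution `u` whose flux `w ∇u` is `exp (-x ^ α / 2)`: the flux decreases for all `x`, and
`u(x)` is of order `x ^ (1 - 2 α) exp (x ^ α / 2)`, which yields the Hardy inequality with weight
`x ^ (3 α - 2)` and a constant independent of `n` (`hardy_chain`). The quotient of the two weights
is `x ^ (2 - 3 α + α a)`, which is at most `N ^ γ` if `γ ≥ 0` and at most `1` if `γ ≤ 0`.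

*Upper bound, `d = 1`.* The measure is almost uniform and `1 - log μ` is of order `log N`, so the
above loses a logarithm. Instead, the oscillation of `f` is at most a multiple of
`N ℰ(f) ^ (1/2)`, and the gap of a function with oscillation `D` is at most `4 ε D²`
(`becknerGap_le_of_abs_sub_le`).

*Lower bounds.* The test function is the linear ramp `(x - m)₊` over the last `n - m ≈ N / 2` points
of the chain, a stretch over which `x ^ α` varies by at most `2`. Its Rayleigh quotient
`∫ f² dμ / ℰ(f)` is at least of order `N ^ (3 - d)` (`le_of_mean_ramp_sq_le`), and its support has
measure at most `exp (-N ^ (d - 1) / 4)` (`sum_mu_rampSupport_le`). By Hölder's inequality the gap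
is at least `∫ f² dμ` times a constant when `ε` is of order `N ^ (1 - d)`, by Jensen's inequality
the entropy is at least `N ^ (d - 1) / 4` times `∫ f² dμ`, and by the Cauchy-Schwarz inequality the
variance is at least a constant times `∫ f² dμ`.
-/

noncomputable section

namespace ToyModel

/-! ### The Beckner gap on a finite probability space -/

/-- The left-hand side `∫ f² dμ - (∫ |f|^p dμ)^(2/p)` of the Beckner inequality for the weights
`μ` on the finite set `s`. -/
def becknerGap {ι : Type*} (s : Finset ι) (μ : ι → ℝ) (p : ℝ) (f : ι → ℝ) : ℝ :=
  ∑ x ∈ s, μ x * f x ^ 2 - (∑ x ∈ s, μ x * |f x| ^ p) ^ (2 / p)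

/-- The difference between `t² = σ^(2/p)`, as a function of `σ = t^p`, and its tangent line at
`σ = 1`. -/
def remainder (p t : ℝ) : ℝ := t ^ 2 - 1 - 2 / p * (t ^ p - 1)

theorem remainder_le_sq {p t : ℝ} (hp : 1 ≤ p) (ht : 0 ≤ t) : remainder p t ≤ (t - 1) ^ 2 := by
  have h := one_add_mul_self_le_rpow_one_add (s := t - 1) (by linarith) hp
  rw [add_sub_cancel] at h
  have h2 : 2 / p * (p * (t - 1)) ≤ 2 / p * (t ^ p - 1) :=
    mul_le_mul_of_nonneg_left (by linarith) (by positivity)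
  have h3 : 2 / p * (p * (t - 1)) = 2 * (t - 1) := by field_simp
  unfold remainder
  nlinarith

theorem hasDerivAt_remainder {p t : ℝ} (hp : p ≠ 0) (ht : t ≠ 0) :
    HasDerivAt (remainder p) (2 * t - 2 * t ^ (p - 1)) t := by
  have h1 := (Real.hasDerivAt_rpow_const (x := t) (p := p) (Or.inl ht))
  have h2 := (((hasDerivAt_pow 2 t).sub_const 1).sub ((h1.sub_const 1).const_mul (2 / p)))
  refine (h2.congr_deriv ?_)
  simp only [Nat.cast_ofNat, Nat.add_one_sub_one, pow_one]
  field_simp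

theorem continuous_remainder {p : ℝ} (hp : 0 ≤ p) : Continuous (remainder p) := by
  unfold remainder
  have : Continuous fun t : ℝ => t ^ p := Real.continuous_rpow_const hp
  fun_prop

theorem remainder_one (p : ℝ) : remainder p 1 = 0 := by simp [remainder]

theorem remainder_le_of_le_one {p t : ℝ} (hp : p ∈ Set.Ioo (1 : ℝ) 2) (ht : 0 ≤ t)
    (ht1 : t ≤ 1) : remainder p t ≤ (2 - p) * (t - 1) ^ 2 := by
  obtain ⟨hp1, hp2⟩ := hp
  have hd : ∀ s : ℝ, 0 < s → HasDerivAt (fun s => (2 - p) * (s - 1) ^ 2 - remainder p s)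
      (2 * (s ^ (p - 1) - (p - 1) * s - (2 - p))) s := fun s hs => by
    have h1 := ((((hasDerivAt_id s).sub_const 1).pow 2).const_mul (2 - p)).sub
      (hasDerivAt_remainder (p := p) (by linarith) hs.ne')
    refine h1.congr_deriv ?_
    simp only [id]
    push_cast
    ring
  have hanti : AntitoneOn (fun s => (2 - p) * (s - 1) ^ 2 - remainder p s) (Set.Icc 0 1) := by
    refine antitoneOn_of_deriv_nonpos (convex_Icc 0 1) ?_ ?_ ?_
    · have := continuous_remainder (p := p) (by linarith)
      fun_prop
    · intro s hs
      rw [interior_Icc] at hs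
      exact (hd s hs.1).differentiableAt.differentiableWithinAt
    · intro s hs
      rw [interior_Icc] at hs
      rw [(hd s hs.1).deriv]
      -- weighted arithmetic-geometric mean inequality
      have := Real.geom_mean_le_arith_mean2_weighted (w₁ := p - 1) (w₂ := 2 - p) (p₁ := s)
        (p₂ := 1) (by linarith) (by linarith) hs.1.le zero_le_one (by ring)
      rw [Real.one_rpow] at this
      linarith
  have h := hanti ⟨ht, ht1⟩ ⟨zero_le_one, le_rfl⟩ ht1
  simp only [remainder_one] at h
  norm_num at h
  linarith

theorem remainder_le_of_one_le {p t : ℝ} (hp : p ∈ Set.Ioo (1 : ℝ) 2) (ht : 1 ≤ t) :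
    remainder p t ≤ (2 - p) * ((t - 1) ^ 2 * (1 + Real.log t)) := by
  obtain ⟨hp1, hp2⟩ := hp
  have hd : ∀ s : ℝ, 0 < s → HasDerivAt
      (fun s => (2 - p) * ((s - 1) ^ 2 * (1 + Real.log s)) - remainder p s)
      ((2 - p) * (2 * (s - 1) * (1 + Real.log s) + (s - 1) ^ 2 * s⁻¹)
        - (2 * s - 2 * s ^ (p - 1))) s := fun s hs => by
    have h1 := (((((hasDerivAt_id s).sub_const 1).pow 2).mul
      ((Real.hasDerivAt_log hs.ne').const_add 1)).const_mul (2 - p)).sub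
      (hasDerivAt_remainder (p := p) (by linarith) hs.ne')
    refine h1.congr_deriv ?_
    simp only [id, Pi.pow_apply]
    push_cast
    ring
  have hmono : MonotoneOn
      (fun s => (2 - p) * ((s - 1) ^ 2 * (1 + Real.log s)) - remainder p s) (Set.Icc 1 t) := by
    refine monotoneOn_of_deriv_nonneg (convex_Icc 1 t) ?_ ?_ ?_
    · intro s hs
      exact (hd s (by linarith [hs.1])).continuousAt.continuousWithinAt
    · intro s hs
      rw [interior_Icc] at hs
      exact (hd s (by linarith [hs.1])).differentiableAt.differentiableWithinAt
    · intro s hs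
      rw [interior_Icc] at hs
      have hs0 : 0 < s := by linarith [hs.1]
      rw [(hd s hs0).deriv]
      have hl0 : 0 ≤ Real.log s := Real.log_nonneg hs.1.le
      have hl1 : Real.log s ≤ s - 1 := Real.log_le_sub_one_of_pos hs0
      have hpow : s - s ^ (p - 1) ≤ (2 - p) * (s * Real.log s) := by
        have e1 : s ^ (p - 1) = s * Real.exp (-((2 - p) * Real.log s)) := by
          rw [show p - 1 = 1 + -(2 - p) by ring, Real.rpow_add hs0, Real.rpow_one,
            Real.rpow_def_of_pos hs0]
          ring_nf
        have e2 := Real.add_one_le_exp (-((2 - p) * Real.log s))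
        rw [e1]
        nlinarith
      have h3 : s * Real.log s ≤ (s - 1) * (1 + Real.log s) := by nlinarith
      have h4 : 0 ≤ (2 - p) * ((s - 1) ^ 2 * s⁻¹) :=
        mul_nonneg (by linarith) (by positivity)
      have h5 := mul_le_mul_of_nonneg_left h3 (by linarith : 0 ≤ 2 - p)
      nlinarith
  have h := hmono ⟨le_rfl, ht⟩ ⟨ht, le_rfl⟩ ht
  simp only [remainder_one] at h
  norm_num at h
  linarith

/-- The remainder is at most `(t - 1)²`, and for `p` near `2` it gains the factor `2 - p` at the
cost of a logarithm. -/
theorem remainder_le_log {p t : ℝ} (hp : p ∈ Set.Ioo (1 : ℝ) 2) (ht : 0 ≤ t) :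
    remainder p t ≤ (t - 1) ^ 2 * ((2 - p) * (1 + Real.log (max t 1))) := by
  rcases le_total t 1 with h | h
  · rw [max_eq_right h]
    have := remainder_le_of_le_one hp ht h
    simp only [Real.log_one]
    linarith
  · rw [max_eq_left h]
    have := remainder_le_of_one_le hp h
    linarith

theorem min_one_le_rpow {u a : ℝ} (hu : 0 ≤ u) (ha0 : 0 < a) (ha1 : a ≤ 1) :
    min 1 u ≤ u ^ a := by
  rcases le_total 1 u with h | h
  · exact (min_le_left _ _).trans (Real.one_le_rpow h ha0.le)
  · exact (min_le_right _ _).trans (Real.self_le_rpow_of_le_one hu h ha1)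

theorem remainder_le_rpow {p t a : ℝ} (hp : p ∈ Set.Ioo (1 : ℝ) 2) (ha0 : 0 < a) (ha1 : a ≤ 1)
    (ht : 0 ≤ t) :
    remainder p t ≤ (t - 1) ^ 2 * ((2 - p) * (1 + Real.log (max t 1))) ^ a := by
  have hl : 0 ≤ Real.log (max t 1) := Real.log_nonneg (le_max_right _ _)
  have hu : 0 ≤ (2 - p) * (1 + Real.log (max t 1)) :=
    mul_nonneg (by linarith [hp.2]) (by linarith)
  refine le_trans ?_ (mul_le_mul_of_nonneg_left (min_one_le_rpow hu ha0 ha1) (sq_nonneg _))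
  rw [mul_min_of_nonneg _ _ (sq_nonneg _), mul_one]
  exact le_min (remainder_le_sq hp.1.le ht) (remainder_le_log hp ht)

section Gap

variable {ι : Type*} {s : Finset ι} {μ : ι → ℝ}

theorem becknerGap_const_mul (hμ : ∀ x ∈ s, 0 ≤ μ x) {p : ℝ} (hp : 0 < p) (c : ℝ) (f : ι → ℝ) :
    becknerGap s μ p (fun x => c * f x) = c ^ 2 * becknerGap s μ p f := by
  have h1 : ∑ x ∈ s, μ x * (c * f x) ^ 2 = c ^ 2 * ∑ x ∈ s, μ x * f x ^ 2 := by
    rw [Finset.mul_sum]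
    exact Finset.sum_congr rfl fun x _ => by ring
  have h2 : ∑ x ∈ s, μ x * |c * f x| ^ p = |c| ^ p * ∑ x ∈ s, μ x * |f x| ^ p := by
    rw [Finset.mul_sum]
    refine Finset.sum_congr rfl fun x _ => ?_
    rw [abs_mul, Real.mul_rpow (abs_nonneg _) (abs_nonneg _)]
    ring
  have h3 : 0 ≤ ∑ x ∈ s, μ x * |f x| ^ p :=
    Finset.sum_nonneg fun x hx => mul_nonneg (hμ x hx) (by positivity)
  have h4 : (|c| ^ p) ^ (2 / p) = c ^ 2 := by
    rw [← Real.rpow_mul (abs_nonneg c), mul_div_cancel₀ _ hp.ne', Real.rpow_two, sq_abs]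
  unfold becknerGap
  rw [h1, h2, Real.mul_rpow (by positivity) h3, h4]
  ring

/-- Bernoulli's inequality linearizes the power `2 / p`. -/
theorem becknerGap_le_linear (hμ : ∀ x ∈ s, 0 ≤ μ x) {p : ℝ} (hp : p ∈ Set.Ioo (1 : ℝ) 2)
    (f : ι → ℝ) :
    becknerGap s μ p f ≤
      ∑ x ∈ s, μ x * f x ^ 2 - 1 - 2 / p * (∑ x ∈ s, μ x * |f x| ^ p - 1) := by
  have h3 : 0 ≤ ∑ x ∈ s, μ x * |f x| ^ p :=
    Finset.sum_nonneg fun x hx => mul_nonneg (hμ x hx) (by positivity)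
  have h := one_add_mul_self_le_rpow_one_add (s := ∑ x ∈ s, μ x * |f x| ^ p - 1) (by linarith)
    (p := 2 / p) (by rw [le_div_iff₀ (by linarith [hp.1])]; linarith [hp.2])
  rw [add_sub_cancel] at h
  unfold becknerGap
  linarith

theorem becknerGap_le_remainder (hμ : ∀ x ∈ s, 0 ≤ μ x) (hμ1 : ∑ x ∈ s, μ x = 1) {p : ℝ}
    (hp : p ∈ Set.Ioo (1 : ℝ) 2) (f : ι → ℝ) :
    becknerGap s μ p f ≤ ∑ x ∈ s, μ x * remainder p |f x| := by
  refine (becknerGap_le_linear hμ hp f).trans_eq ?_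
  have : ∀ x ∈ s, μ x * remainder p |f x| =
      μ x * f x ^ 2 - μ x - 2 / p * (μ x * |f x| ^ p - μ x) := fun x _ => by
    unfold remainder
    rw [sq_abs]
    ring
  rw [Finset.sum_congr rfl this, Finset.sum_sub_distrib, Finset.sum_sub_distrib, ← Finset.mul_sum,
    Finset.sum_sub_distrib, hμ1]

theorem one_sub_rpow_le_exp_neg {u a : ℝ} (hu : 0 ≤ u) (ha0 : 0 < a) (ha1 : a ≤ 1) :
    1 - u ^ a ≤ Real.exp (-u) := by
  have h := min_one_le_rpow hu ha0 ha1
  have h1 := Real.add_one_le_exp (-u)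
  have h2 := Real.exp_pos (-u)
  rcases min_le_iff.1 h with h | h <;> linarith

/-- Since `f² μ ≤ ∫ f² dμ` at each atom, `f` is at most a power of the inverse mass of the atom,
and the gap is bounded by a quadratic form in `f`. -/
theorem becknerGap_le_log (hμ : ∀ x ∈ s, 0 < μ x) (hμ1 : ∑ x ∈ s, μ x = 1) {p a : ℝ}
    (hp : p ∈ Set.Ioo (1 : ℝ) 2) (ha0 : 0 < a) (ha1 : a ≤ 1) (f : ι → ℝ) :
    becknerGap s μ p f ≤
      2 * (2 - p) ^ a * ∑ x ∈ s, μ x * (f x ^ 2 * (1 - Real.log (μ x)) ^ a) := by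
  have hμ0 : ∀ x ∈ s, 0 ≤ μ x := fun x hx => (hμ x hx).le
  obtain ⟨hp1, hp2⟩ := hp
  have hε : 0 < 2 - p := by linarith
  have hμle : ∀ x ∈ s, μ x ≤ 1 := fun x hx => hμ1 ▸ Finset.single_le_sum hμ0 hx
  have hL : ∀ x ∈ s, 0 ≤ -Real.log (μ x) := fun x hx => by
    linarith [Real.log_nonpos (hμ0 x hx) (hμle x hx)]
  -- the case `∫ f² dμ = 1`; the general case follows by homogeneity
  have key : ∀ h : ι → ℝ, ∑ x ∈ s, μ x * h x ^ 2 = 1 → becknerGap s μ p h ≤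
      2 * (2 - p) ^ a * ∑ x ∈ s, μ x * (h x ^ 2 * (1 - Real.log (μ x)) ^ a) := by
    intro h hh
    set T := ∑ x ∈ s, μ x * (h x ^ 2 * (1 - Real.log (μ x)) ^ a) with hT
    have hT0 : 0 ≤ T := Finset.sum_nonneg fun x hx => mul_nonneg (hμ0 x hx)
      (mul_nonneg (sq_nonneg _) (Real.rpow_nonneg (by linarith [hL x hx]) _))
    have hpt : ∀ x ∈ s, μ x * h x ^ 2 -
        (2 - p) ^ a * (μ x * (h x ^ 2 * (1 - Real.log (μ x)) ^ a)) ≤ μ x * |h x| ^ p := by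
      intro x hx
      have hm : h x ^ 2 * μ x ≤ 1 := by
        rw [← hh, mul_comm]
        exact Finset.single_le_sum (f := fun x => μ x * h x ^ 2)
          (fun y hy => mul_nonneg (hμ0 y hy) (sq_nonneg _)) hx
      have h1 : h x ^ 2 * (μ x) ^ ((2 - p) / 2) ≤ |h x| ^ p := by
        have e1 : h x ^ 2 = |h x| ^ p * (h x ^ 2) ^ ((2 - p) / 2) := by
          rw [← sq_abs, ← Real.rpow_natCast |h x| 2, ← Real.rpow_mul (abs_nonneg _),
            ← Real.rpow_add_of_nonneg (abs_nonneg _) (by linarith)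
              (by push_cast; linarith)]
          congr 1
          push_cast
          ring
        calc h x ^ 2 * (μ x) ^ ((2 - p) / 2)
            = |h x| ^ p * ((h x ^ 2) ^ ((2 - p) / 2) * (μ x) ^ ((2 - p) / 2)) := by
              conv_lhs => rw [e1]
              ring
          _ = |h x| ^ p * (h x ^ 2 * μ x) ^ ((2 - p) / 2) := by
              rw [Real.mul_rpow (sq_nonneg _) (hμ0 x hx)]
          _ ≤ |h x| ^ p * 1 := by
              refine mul_le_mul_of_nonneg_left (Real.rpow_le_one ?_ hm (by linarith))
                (by positivity)
              exact mul_nonneg (sq_nonneg _) (hμ0 x hx)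
          _ = |h x| ^ p := mul_one _
      have h2 : 1 - (2 - p) ^ a * (1 - Real.log (μ x)) ^ a ≤ (μ x) ^ ((2 - p) / 2) := by
        have hu : 0 ≤ (2 - p) / 2 * -Real.log (μ x) := mul_nonneg (by linarith) (hL x hx)
        have h3 := one_sub_rpow_le_exp_neg hu ha0 ha1
        have h4 : ((2 - p) / 2 * -Real.log (μ x)) ^ a ≤ (2 - p) ^ a * (1 - Real.log (μ x)) ^ a := by
          rw [← Real.mul_rpow hε.le (by linarith [hL x hx])]
          refine Real.rpow_le_rpow hu ?_ ha0.le
          nlinarith [hL x hx]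
        rw [Real.rpow_def_of_pos (hμ x hx)]
        have h5 : -((2 - p) / 2 * -Real.log (μ x)) = Real.log (μ x) * ((2 - p) / 2) := by ring
        rw [h5] at h3
        linarith
      have h6 := mul_le_mul_of_nonneg_left h2 (sq_nonneg (h x))
      have h7 := mul_le_mul_of_nonneg_left (h6.trans h1) (hμ0 x hx)
      linarith
    have hX := Finset.sum_le_sum hpt
    rw [Finset.sum_sub_distrib, ← Finset.mul_sum, hh, ← hT] at hX
    have hlin := becknerGap_le_linear hμ0 ⟨hp1, hp2⟩ h
    rw [hh] at hlin
    have h2p : 2 / p ≤ 2 := by rw [div_le_iff₀ (by linarith)]; linarith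
    have h2p0 : 0 ≤ 2 / p := by positivity
    have hεT : 0 ≤ (2 - p) ^ a * T := mul_nonneg (Real.rpow_nonneg hε.le _) hT0
    have h8 : 2 / p * (-((2 - p) ^ a * T)) ≤ 2 / p * (∑ x ∈ s, μ x * |h x| ^ p - 1) :=
      mul_le_mul_of_nonneg_left (by linarith) h2p0
    nlinarith [mul_le_mul_of_nonneg_right h2p hεT]
  set Q := ∑ x ∈ s, μ x * f x ^ 2 with hQ
  have hQ0 : 0 ≤ Q := Finset.sum_nonneg fun x hx => mul_nonneg (hμ0 x hx) (sq_nonneg _)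
  rcases hQ0.eq_or_lt with h0 | hpos
  · have h1 : becknerGap s μ p f ≤ 0 := by
      unfold becknerGap
      rw [← hQ, ← h0]
      have : 0 ≤ (∑ x ∈ s, μ x * |f x| ^ p) ^ (2 / p) :=
        Real.rpow_nonneg (Finset.sum_nonneg fun x hx => mul_nonneg (hμ0 x hx) (by positivity)) _
      linarith
    refine h1.trans (mul_nonneg (by positivity) (Finset.sum_nonneg fun x hx => ?_))
    exact mul_nonneg (hμ0 x hx) (mul_nonneg (sq_nonneg _)
      (Real.rpow_nonneg (by linarith [hL x hx]) _))
  · set c := Real.sqrt Q with hc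
    have hc0 : c ≠ 0 := (Real.sqrt_pos.2 hpos).ne'
    have hc2 : c ^ 2 = Q := Real.sq_sqrt hQ0
    have hf : f = fun x => c * (c⁻¹ * f x) := by
      funext x
      rw [mul_inv_cancel_left₀ hc0]
    have hnorm : ∑ x ∈ s, μ x * (c⁻¹ * f x) ^ 2 = 1 := by
      have : ∀ x ∈ s, μ x * (c⁻¹ * f x) ^ 2 = Q⁻¹ * (μ x * f x ^ 2) := fun x _ => by
        rw [mul_pow, inv_pow, hc2]
        ring
      rw [Finset.sum_congr rfl this, ← Finset.mul_sum, ← hQ, inv_mul_cancel₀ hpos.ne']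
    have h1 := mul_le_mul_of_nonneg_left (key _ hnorm) (sq_nonneg c)
    rw [← becknerGap_const_mul hμ0 (by linarith) c (fun x => c⁻¹ * f x), ← hf] at h1
    refine h1.trans_eq ?_
    rw [mul_left_comm, Finset.mul_sum]
    congr 1
    refine Finset.sum_congr rfl fun x _ => ?_
    rw [mul_pow, inv_pow]
    field_simp

/-- Linearization around a constant `c ≠ 0`. -/
theorem becknerGap_le_sum_of_remainder_le (hμ : ∀ x ∈ s, 0 ≤ μ x) (hμ1 : ∑ x ∈ s, μ x = 1) {p : ℝ}
    (hp : p ∈ Set.Ioo (1 : ℝ) 2) (f : ι → ℝ) {c : ℝ} (hc : c ≠ 0) (v : ι → ℝ)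
    (hv : ∀ x ∈ s, 0 ≤ v x)
    (h : ∀ x ∈ s, remainder p |c⁻¹ * f x| ≤ (|c⁻¹ * f x| - 1) ^ 2 * v x) :
    becknerGap s μ p f ≤ ∑ x ∈ s, μ x * ((f x - c) ^ 2 * v x) := by
  have hf : f = fun x => c * (c⁻¹ * f x) := by
    funext x
    rw [mul_inv_cancel_left₀ hc]
  have h1 : becknerGap s μ p f = c ^ 2 * becknerGap s μ p (fun x => c⁻¹ * f x) := by
    conv_lhs => rw [hf]
    exact becknerGap_const_mul hμ (by linarith [hp.1]) c _
  rw [h1]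
  refine (mul_le_mul_of_nonneg_left (becknerGap_le_remainder hμ hμ1 hp _) (sq_nonneg c)).trans ?_
  rw [Finset.mul_sum]
  refine Finset.sum_le_sum fun x hx => ?_
  have h2 : (|c⁻¹ * f x| - 1) ^ 2 ≤ (c⁻¹ * f x - 1) ^ 2 := by
    nlinarith [le_abs_self (c⁻¹ * f x), sq_abs (c⁻¹ * f x)]
  have h3 : remainder p |c⁻¹ * f x| ≤ (c⁻¹ * f x - 1) ^ 2 * v x :=
    (h x hx).trans (mul_le_mul_of_nonneg_right h2 (hv x hx))
  calc c ^ 2 * (μ x * remainder p |c⁻¹ * f x|)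
      ≤ c ^ 2 * (μ x * ((c⁻¹ * f x - 1) ^ 2 * v x)) := by
        have := mul_le_mul_of_nonneg_left h3 (hμ x hx)
        exact mul_le_mul_of_nonneg_left this (sq_nonneg c)
    _ = μ x * ((f x - c) ^ 2 * v x) := by
        have : (f x - c) ^ 2 = c ^ 2 * (c⁻¹ * f x - 1) ^ 2 := by
          rw [← mul_pow, mul_sub, mul_inv_cancel_left₀ hc, mul_one]
        rw [this]
        ring

/-- The centred form of `becknerGap_le_log`. If `∫ f² dμ` is comparable with `c²`, the gap is
linearized around the constant `c`; otherwise `∫ f² dμ` is controlled by `∫ (f - c)² dμ`. -/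
theorem becknerGap_le_centred (hμ : ∀ x ∈ s, 0 < μ x) (hμ1 : ∑ x ∈ s, μ x = 1) {p a : ℝ}
    (hp : p ∈ Set.Ioo (1 : ℝ) 2) (ha0 : 0 < a) (ha1 : a ≤ 1) (f : ι → ℝ) (c : ℝ) :
    becknerGap s μ p f ≤
      4 * (1 + ∑ x ∈ s, μ x * (1 - Real.log (μ x)) ^ a) * (2 - p) ^ a *
        ∑ x ∈ s, μ x * ((f x - c) ^ 2 * (1 - Real.log (μ x)) ^ a) := by
  have hμ0 : ∀ x ∈ s, 0 ≤ μ x := fun x hx => (hμ x hx).le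
  have hε : 0 < 2 - p := by linarith [hp.2]
  have hμle : ∀ x ∈ s, μ x ≤ 1 := fun x hx => hμ1 ▸ Finset.single_le_sum hμ0 hx
  have hL : ∀ x ∈ s, 0 ≤ -Real.log (μ x) := fun x hx => by
    linarith [Real.log_nonpos (hμ0 x hx) (hμle x hx)]
  set V : ι → ℝ := fun x => (1 - Real.log (μ x)) ^ a with hV
  have hV1 : ∀ x ∈ s, 1 ≤ V x := fun x hx => Real.one_le_rpow (by linarith [hL x hx]) ha0.le
  set M := ∑ x ∈ s, μ x * V x with hM
  set T := ∑ x ∈ s, μ x * ((f x - c) ^ 2 * V x) with hT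
  set E := (2 - p) ^ a with hE
  have hE0 : 0 < E := Real.rpow_pos_of_pos hε _
  have hM0 : 0 ≤ M := Finset.sum_nonneg fun x hx => mul_nonneg (hμ0 x hx) (by linarith [hV1 x hx])
  have hT0 : 0 ≤ T := Finset.sum_nonneg fun x hx => mul_nonneg (hμ0 x hx)
    (mul_nonneg (sq_nonneg _) (by linarith [hV1 x hx]))
  by_cases hcase : 4 * c ^ 2 ≤ ∑ x ∈ s, μ x * f x ^ 2
  · have hGT : ∑ x ∈ s, μ x * (f x - c) ^ 2 ≤ T := by
      refine Finset.sum_le_sum fun x hx => mul_le_mul_of_nonneg_left ?_ (hμ0 x hx)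
      exact le_mul_of_one_le_right (sq_nonneg _) (hV1 x hx)
    have hcG : c ^ 2 ≤ ∑ x ∈ s, μ x * (f x - c) ^ 2 := by
      have h1 : ∑ x ∈ s, μ x * f x ^ 2 ≤ 2 * ∑ x ∈ s, μ x * (f x - c) ^ 2 + 2 * c ^ 2 := by
        have e : 2 * c ^ 2 = ∑ x ∈ s, μ x * (2 * c ^ 2) := by rw [← Finset.sum_mul, hμ1, one_mul]
        rw [e, Finset.mul_sum, ← Finset.sum_add_distrib]
        refine Finset.sum_le_sum fun x hx => ?_
        have := mul_nonneg (hμ0 x hx) (sq_nonneg (f x - 2 * c))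
        nlinarith
      linarith
    have hFT : ∑ x ∈ s, μ x * (f x ^ 2 * V x) ≤ 2 * T + 2 * c ^ 2 * M := by
      rw [hT, hM, Finset.mul_sum, Finset.mul_sum, ← Finset.sum_add_distrib]
      refine Finset.sum_le_sum fun x hx => ?_
      have := mul_nonneg (mul_nonneg (hμ0 x hx) (by linarith [hV1 x hx] : 0 ≤ V x))
        (sq_nonneg (f x - 2 * c))
      nlinarith
    have h2 : c ^ 2 * M ≤ T * M := mul_le_mul_of_nonneg_right (hcG.trans hGT) hM0
    refine (becknerGap_le_log hμ hμ1 hp ha0 ha1 f).trans ?_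
    calc 2 * E * ∑ x ∈ s, μ x * (f x ^ 2 * V x) ≤ 2 * E * (2 * T + 2 * (T * M)) :=
          mul_le_mul_of_nonneg_left (by linarith) (by positivity)
      _ = 4 * (1 + M) * E * T := by ring
  · rw [not_le] at hcase
    have hc : c ≠ 0 := by
      rintro rfl
      have : 0 ≤ ∑ x ∈ s, μ x * f x ^ 2 :=
        Finset.sum_nonneg fun x hx => mul_nonneg (hμ0 x hx) (sq_nonneg _)
      norm_num at hcase
      linarith
    have h1 : becknerGap s μ p f ≤ ∑ x ∈ s, μ x * ((f x - c) ^ 2 * (2 * (E * V x))) := by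
      refine becknerGap_le_sum_of_remainder_le hμ0 hμ1 hp f hc _
        (fun x hx => by have := hV1 x hx; positivity) fun x hx => ?_
      refine (remainder_le_rpow hp ha0 ha1 (abs_nonneg _)).trans
        (mul_le_mul_of_nonneg_left ?_ (sq_nonneg _))
      have hm : |c⁻¹ * f x| ^ 2 * μ x ≤ 4 := by
        have h3 : μ x * f x ^ 2 ≤ 4 * c ^ 2 := (Finset.single_le_sum (f := fun x => μ x * f x ^ 2)
          (fun y hy => mul_nonneg (hμ0 y hy) (sq_nonneg _)) hx).trans hcase.le
        have h4 : |c⁻¹ * f x| ^ 2 * μ x = (μ x * f x ^ 2) / c ^ 2 := by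
          rw [sq_abs]
          field_simp
        rw [h4, div_le_iff₀ (by positivity)]
        exact h3
      have hlog : Real.log (max |c⁻¹ * f x| 1) ≤ 1 - Real.log (μ x) := by
        have h5 : (max |c⁻¹ * f x| 1) ^ 2 * μ x ≤ 4 := by
          rcases le_total |c⁻¹ * f x| 1 with h | h
          · rw [max_eq_right h]
            linarith [hμle x hx]
          · rw [max_eq_left h]
            exact hm
        have h6 : 0 < max |c⁻¹ * f x| 1 := lt_max_of_lt_right one_pos
        have h7 := Real.log_le_log (by have := hμ x hx; positivity) h5
        rw [Real.log_mul (by positivity) (hμ x hx).ne', Real.log_pow,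
          show (4 : ℝ) = 2 ^ 2 by norm_num, Real.log_pow] at h7
        push_cast at h7
        linarith [Real.log_two_lt_d9, hL x hx]
      have h8 : 0 ≤ Real.log (max |c⁻¹ * f x| 1) := Real.log_nonneg (le_max_right _ _)
      calc ((2 - p) * (1 + Real.log (max |c⁻¹ * f x| 1))) ^ a
          ≤ (2 * ((2 - p) * (1 - Real.log (μ x)))) ^ a := by
            refine Real.rpow_le_rpow (mul_nonneg hε.le (by linarith)) ?_ ha0.le
            nlinarith [hL x hx]
        _ = 2 ^ a * (E * V x) := by
            have : 0 ≤ 1 - Real.log (μ x) := by linarith [hL x hx]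
            rw [Real.mul_rpow (by norm_num) (by positivity), Real.mul_rpow hε.le this]
        _ ≤ 2 * (E * V x) := by
            refine mul_le_mul_of_nonneg_right ?_ (by have := hV1 x hx; positivity)
            calc (2 : ℝ) ^ a ≤ 2 ^ (1 : ℝ) := Real.rpow_le_rpow_of_exponent_le (by norm_num) ha1
              _ = 2 := Real.rpow_one _
    have h2 : ∑ x ∈ s, μ x * ((f x - c) ^ 2 * (2 * (E * V x))) = 2 * E * T := by
      rw [hT, Finset.mul_sum]
      exact Finset.sum_congr rfl fun x _ => by ring
    rw [h2] at h1
    refine h1.trans ?_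
    nlinarith [mul_nonneg hE0.le hT0, mul_nonneg hM0 (mul_nonneg hE0.le hT0)]

/-- The gap of a function of bounded oscillation is of order `2 - p`. -/
theorem becknerGap_le_of_abs_sub_le (hμ : ∀ x ∈ s, 0 ≤ μ x) (hμ1 : ∑ x ∈ s, μ x = 1) {p : ℝ}
    (hp : p ∈ Set.Ioo (1 : ℝ) 2) (f : ι → ℝ) {c D : ℝ} (hD : ∀ x ∈ s, |f x - c| ≤ D) :
    becknerGap s μ p f ≤ 4 * (2 - p) * D ^ 2 := by
  obtain ⟨hp1, hp2⟩ := hp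
  have hε : 0 < 2 - p := by linarith
  have hs : s.Nonempty := by
    rw [Finset.nonempty_iff_ne_empty]
    rintro rfl
    simp at hμ1
  have hD0 : 0 ≤ D := by
    obtain ⟨x, hx⟩ := hs
    exact (abs_nonneg _).trans (hD x hx)
  by_cases hDc : D < |c|
  · have hc : c ≠ 0 := abs_pos.1 (hD0.trans_lt hDc)
    have h1 : becknerGap s μ p f ≤ ∑ x ∈ s, μ x * ((f x - c) ^ 2 * (2 * (2 - p))) := by
      refine becknerGap_le_sum_of_remainder_le hμ hμ1 ⟨hp1, hp2⟩ f hc _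
        (fun x hx => by positivity) fun x hx => ?_
      refine (remainder_le_log ⟨hp1, hp2⟩ (abs_nonneg _)).trans
        (mul_le_mul_of_nonneg_left ?_ (sq_nonneg _))
      have ht : |c⁻¹ * f x| ≤ 2 := by
        rw [abs_mul, abs_inv, inv_mul_le_iff₀ (abs_pos.2 hc)]
        have := abs_sub_abs_le_abs_sub (f x) c
        linarith [hD x hx]
      have hl : Real.log (max |c⁻¹ * f x| 1) ≤ 1 := by
        have := Real.log_le_sub_one_of_pos (lt_max_of_lt_right one_pos : 0 < max |c⁻¹ * f x| 1)
        have h2 : max |c⁻¹ * f x| 1 ≤ 2 := max_le ht (by norm_num)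
        linarith
      nlinarith
    refine h1.trans ?_
    have h2 : ∑ x ∈ s, μ x * ((f x - c) ^ 2 * (2 * (2 - p))) ≤
        ∑ x ∈ s, μ x * (D ^ 2 * (2 * (2 - p))) := by
      refine Finset.sum_le_sum fun x hx => mul_le_mul_of_nonneg_left ?_ (hμ x hx)
      refine mul_le_mul_of_nonneg_right ?_ (by positivity)
      rw [← sq_abs]
      exact pow_le_pow_left₀ (abs_nonneg _) (hD x hx) 2
    rw [← Finset.sum_mul, hμ1] at h2
    nlinarith [sq_nonneg D]
  · rw [not_lt] at hDc
    have hf : ∀ x ∈ s, |f x| ≤ 2 * D := fun x hx => by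
      have := abs_sub_abs_le_abs_sub (f x) c
      linarith [hD x hx]
    rcases hD0.eq_or_lt with h0 | hDpos
    · have hz : ∀ x ∈ s, f x = 0 := fun x hx => by
        have := hf x hx
        rw [← h0, mul_zero] at this
        exact abs_nonpos_iff.1 this
      have : becknerGap s μ p f ≤ 0 := by
        unfold becknerGap
        rw [Finset.sum_eq_zero fun x hx => by rw [hz x hx]; ring]
        have : 0 ≤ (∑ x ∈ s, μ x * |f x| ^ p) ^ (2 / p) :=
          Real.rpow_nonneg (Finset.sum_nonneg fun x hx => mul_nonneg (hμ x hx) (by positivity)) _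
        linarith
      exact this.trans (by positivity)
    -- after scaling, `|h| ≤ 1`, so `∫ |h|^p ≥ ∫ h²`
    set h : ι → ℝ := fun x => (2 * D)⁻¹ * f x with hh
    have hf2 : f = fun x => (2 * D) * h x := by
      funext x
      rw [hh]
      field_simp
    have hle : ∀ x ∈ s, |h x| ≤ 1 := fun x hx => by
      rw [hh]
      simp only
      rw [abs_mul, abs_inv, abs_of_pos (by positivity : 0 < 2 * D), inv_mul_le_iff₀ (by positivity)]
      linarith [hf x hx]
    rw [hf2, becknerGap_const_mul hμ (by linarith)]
    set m := ∑ x ∈ s, μ x * h x ^ 2 with hm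
    have hm0 : 0 ≤ m := Finset.sum_nonneg fun x hx => mul_nonneg (hμ x hx) (sq_nonneg _)
    have hm1 : m ≤ ∑ x ∈ s, μ x * |h x| ^ p := by
      refine Finset.sum_le_sum fun x hx => mul_le_mul_of_nonneg_left ?_ (hμ x hx)
      rw [← sq_abs, ← Real.rpow_two]
      exact Real.rpow_le_rpow_of_exponent_ge_of_imp (abs_nonneg _) (hle x hx) hp2.le
        (fun _ h => absurd h (by linarith))
    have hgap : becknerGap s μ p h ≤ 2 - p := by
      have h1 : m ^ (2 / p) ≤ (∑ x ∈ s, μ x * |h x| ^ p) ^ (2 / p) :=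
        Real.rpow_le_rpow hm0 hm1 (by positivity)
      have h2 : becknerGap s μ p h ≤ m - m ^ (2 / p) := by
        unfold becknerGap
        linarith
      refine h2.trans ?_
      rcases hm0.eq_or_lt with h0 | hmpos
      · rw [← h0, Real.zero_rpow (by positivity)]
        linarith
      have h3 : m ^ (2 / p) = m * Real.exp (Real.log m * (2 / p - 1)) := by
        conv_lhs => rw [show 2 / p = 1 + (2 / p - 1) by ring, Real.rpow_add hmpos, Real.rpow_one,
          Real.rpow_def_of_pos hmpos]
      have h4 := Real.add_one_le_exp (Real.log m * (2 / p - 1))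
      have h5 := Real.one_sub_inv_le_log_of_pos hmpos
      have h6 : -(m * Real.log m) ≤ 1 := by
        have := mul_le_mul_of_nonneg_left h5 hm0
        rw [mul_sub, mul_inv_cancel₀ hmpos.ne'] at this
        linarith
      have h7 : 0 ≤ 2 / p - 1 := by
        rw [sub_nonneg, le_div_iff₀ (by linarith)]
        linarith
      have h8 : 2 / p - 1 ≤ 2 - p := by
        rw [sub_le_iff_le_add, div_le_iff₀ (by linarith)]
        nlinarith
      have h9 := mul_le_mul_of_nonneg_left h4 hm0
      have h10 := mul_le_mul_of_nonneg_right h6 h7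
      rw [h3]
      nlinarith
    calc (2 * D) ^ 2 * becknerGap s μ p h ≤ (2 * D) ^ 2 * (2 - p) :=
          mul_le_mul_of_nonneg_left hgap (sq_nonneg _)
      _ = 4 * (2 - p) * D ^ 2 := by ring

end Gap

/-! ### The chain: exponents, weights and energy -/

theorem alpha_nonneg {d : ℕ} (hd : 1 ≤ d) : 0 ≤ alpha d := by
  have : (1 : ℝ) ≤ d := by exact_mod_cast hd
  exact div_nonneg (by linarith) (by linarith)

theorem alpha_lt_one {d : ℕ} (hd : 1 ≤ d) : alpha d < 1 := by
  have : (1 : ℝ) ≤ d := by exact_mod_cast hd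
  unfold alpha
  rw [div_lt_one (by linarith)]
  linarith

theorem half_le_alpha {d : ℕ} (hd : 2 ≤ d) : 1 / 2 ≤ alpha d := by
  have : (2 : ℝ) ≤ d := by exact_mod_cast hd
  unfold alpha
  rw [le_div_iff₀ (by linarith)]
  linarith

@[simp] theorem potential_zero (d : ℕ) : potential d 0 = 0 := if_pos rfl

@[simp] theorem potential_succ (d x : ℕ) : potential d (x + 1) = ((x + 1 : ℕ) : ℝ) ^ alpha d :=
  if_neg x.succ_ne_zero

theorem potential_of_pos (d : ℕ) {x : ℕ} (hx : 0 < x) : potential d x = (x : ℝ) ^ alpha d :=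
  if_neg hx.ne'

theorem potential_nonneg (d x : ℕ) : 0 ≤ potential d x := by
  unfold potential
  split_ifs <;> positivity

theorem potential_mono {d : ℕ} (hd : 1 ≤ d) : Monotone (potential d) := by
  intro x y hxy
  rcases Nat.eq_zero_or_pos x with rfl | hx
  · simpa using potential_nonneg d y
  · rw [potential_of_pos d hx, potential_of_pos d (hx.trans_le hxy)]
    exact Real.rpow_le_rpow (by positivity) (by exact_mod_cast hxy) (alpha_nonneg hd)

theorem partitionFunction_pos (d n : ℕ) : 0 < partitionFunction d n :=
  Finset.sum_pos (fun _ _ => Real.exp_pos _) Finset.nonempty_range_add_one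

theorem one_le_partitionFunction (d n : ℕ) : 1 ≤ partitionFunction d n := by
  have := Finset.single_le_sum (f := fun x => Real.exp (-potential d x))
    (fun x _ => (Real.exp_pos _).le) (Finset.mem_range.2 n.succ_pos)
  simpa [partitionFunction] using this

theorem mu_pos (d n x : ℕ) : 0 < mu d n x := div_pos (Real.exp_pos _) (partitionFunction_pos d n)

theorem sum_mu (d n : ℕ) : ∑ x ∈ Finset.range (n + 1), mu d n x = 1 := by
  unfold mu
  rw [← Finset.sum_div]
  exact div_self (partitionFunction_pos d n).ne'

/-- The unnormalized conductance `Z μ(x) b(x) = Z μ(x+1) d(x+1)` of the edge `{x, x + 1}`. -/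
def conductance (d x : ℕ) : ℝ :=
  (if x = 0 then 1 else (x : ℝ) ^ alpha d) * Real.exp (-potential d x)

theorem conductance_pos (d x : ℕ) : 0 < conductance d x := by
  unfold conductance
  split_ifs with h
  · positivity
  · have : 0 < (x : ℝ) := by exact_mod_cast Nat.pos_of_ne_zero h
    positivity

@[simp] theorem conductance_zero (d : ℕ) : conductance d 0 = 1 := by simp [conductance]

/-- Detailed balance. -/
theorem exp_mul_deathRate (d x : ℕ) :
    Real.exp (-potential d (x + 1)) * deathRate d (x + 1) = conductance d x := by
  cases x with
  | zero => simp [deathRate, ← Real.exp_add]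
  | succ x =>
    simp only [deathRate, conductance, potential_succ, Nat.succ_ne_zero, if_false]
    rw [mul_left_comm, ← Real.exp_add]
    congr 2
    ring

theorem energy_eq (d n : ℕ) (f : ℕ → ℝ) :
    energy d n f =
      (∑ x ∈ Finset.range n, conductance d x * (f (x + 1) - f x) ^ 2) / partitionFunction d n := by
  have h1 : ∑ x ∈ Finset.range (n + 1), mu d n x * (birthRate d n x * (f (x + 1) - f x) ^ 2) =
      (∑ x ∈ Finset.range n, conductance d x * (f (x + 1) - f x) ^ 2) / partitionFunction d n := by
    rw [Finset.sum_range_succ, Finset.sum_div]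
    simp only [birthRate, lt_irrefl, if_false, zero_mul, mul_zero, add_zero]
    refine Finset.sum_congr rfl fun x hx => ?_
    rw [if_pos (Finset.mem_range.1 hx), mu, conductance]
    ring
  have h2 : ∑ x ∈ Finset.range (n + 1), mu d n x * (deathRate d x * (f (x - 1) - f x) ^ 2) =
      (∑ x ∈ Finset.range n, conductance d x * (f (x + 1) - f x) ^ 2) / partitionFunction d n := by
    rw [Finset.sum_range_succ', Finset.sum_div]
    rw [show deathRate d 0 = 0 from rfl, zero_mul, mul_zero, add_zero]
    refine Finset.sum_congr rfl fun x _ => ?_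
    rw [← exp_mul_deathRate, mu, Nat.add_sub_cancel]
    ring
  have h3 : energy d n f =
      (∑ x ∈ Finset.range (n + 1), mu d n x * (birthRate d n x * (f (x + 1) - f x) ^ 2) +
        ∑ x ∈ Finset.range (n + 1), mu d n x * (deathRate d x * (f (x - 1) - f x) ^ 2)) / 2 := by
    rw [← Finset.sum_add_distrib, Finset.sum_div, energy, mean]
    refine Finset.sum_congr rfl fun x _ => ?_
    rw [gradSq]
    ring
  rw [h3, h1, h2]
  ring

theorem energy_nonneg (d n : ℕ) (f : ℕ → ℝ) : 0 ≤ energy d n f := by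
  rw [energy_eq]
  exact div_nonneg (Finset.sum_nonneg fun x _ => mul_nonneg (conductance_pos d x).le (sq_nonneg _))
    (partitionFunction_pos d n).le

/-! ### A weighted Hardy inequality -/

/-- Hardy inequality from a positive supersolution `u`, with flux `q = w ∇u`. -/
theorem hardy_of_supersolution {w u g : ℕ → ℝ} (hw : ∀ x, 0 ≤ w x) (hu : ∀ x, 0 < u x)
    (hg : g 0 = 0) (n : ℕ) :
    ∑ x ∈ Finset.range n,
        (w x * (u (x + 1) - u x) - w (x + 1) * (u (x + 2) - u (x + 1))) / u (x + 1) * g (x + 1) ^ 2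
      + w n * (u (n + 1) - u n) * (g n ^ 2 / u n)
      ≤ ∑ x ∈ Finset.range n, w x * (g (x + 1) - g x) ^ 2 := by
  induction n with
  | zero => simp [hg]
  | succ n ih =>
    rw [Finset.sum_range_succ, Finset.sum_range_succ (fun x => w x * (g (x + 1) - g x) ^ 2)]
    have hu0 := hu n
    have hu1 := hu (n + 1)
    have hsq : (u (n + 1) - u n) * (g (n + 1) ^ 2 / u (n + 1) - g n ^ 2 / u n)
        ≤ (g (n + 1) - g n) ^ 2 := by
      have e : (g (n + 1) - g n) ^ 2 -
          (u (n + 1) - u n) * (g (n + 1) ^ 2 / u (n + 1) - g n ^ 2 / u n) =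
          (u n * g (n + 1) - u (n + 1) * g n) ^ 2 / (u n * u (n + 1)) := by
        field_simp
        ring
      have : 0 ≤ (u n * g (n + 1) - u (n + 1) * g n) ^ 2 / (u n * u (n + 1)) := by positivity
      linarith
    have h1 := mul_le_mul_of_nonneg_left hsq (hw n)
    have e2 : (w n * (u (n + 1) - u n) - w (n + 1) * (u (n + 2) - u (n + 1))) / u (n + 1)
          * g (n + 1) ^ 2 + w (n + 1) * (u (n + 2) - u (n + 1)) * (g (n + 1) ^ 2 / u (n + 1)) =
        w n * (u (n + 1) - u n) * (g (n + 1) ^ 2 / u (n + 1)) := by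
      field_simp
      ring
    have e3 : w (n + 1) * (u (n + 1 + 1) - u (n + 1)) * (g (n + 1) ^ 2 / u (n + 1)) =
      w (n + 1) * (u (n + 2) - u (n + 1)) * (g (n + 1) ^ 2 / u (n + 1)) := rfl
    linarith

/-- Lower bound for the increments of the concave function `x ↦ x ^ α`. -/
theorem mul_rpow_le_potential_sub {d : ℕ} (hd : 1 ≤ d) (y : ℕ) :
    alpha d * ((y + 1 : ℕ) : ℝ) ^ (alpha d - 1) ≤ potential d (y + 1) - potential d y := by
  have hα0 := alpha_nonneg hd
  have hα1 := alpha_lt_one hd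
  rcases Nat.eq_zero_or_pos y with rfl | hy
  · simpa using hα1.le
  · have hy0 : 0 < (y : ℝ) := by exact_mod_cast hy
    rw [potential_succ, potential_of_pos d hy]
    set t : ℝ := ((y + 1 : ℕ) : ℝ) with ht
    have hty : (y : ℝ) = t * (1 + -t⁻¹) := by
      have : t ≠ 0 := by positivity
      field_simp
      rw [ht]
      push_cast
      ring
    have ht0 : 0 < t := by positivity
    have ht1 : 0 ≤ 1 + -t⁻¹ := by
      have := (mul_pos_iff_of_pos_left ht0).1 (hty ▸ hy0)
      exact this.le
    have h := rpow_one_add_le_one_add_mul_self (s := -t⁻¹) (by linarith) hα0 hα1.le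
    have h2 : (y : ℝ) ^ alpha d ≤ t ^ alpha d * (1 + alpha d * -t⁻¹) := by
      rw [hty, Real.mul_rpow ht0.le ht1]
      exact mul_le_mul_of_nonneg_left h (by positivity)
    have h3 : t ^ (alpha d - 1) = t ^ alpha d * t⁻¹ := by
      rw [Real.rpow_sub ht0, Real.rpow_one, div_eq_mul_inv]
    rw [h3]
    linarith

/-- Telescoping bound for sums of growing exponentials. -/
theorem sum_exp_potential_le {d : ℕ} (hd : 2 ≤ d) (x : ℕ) (hx : 0 < x) :
    ∑ y ∈ Finset.range x, Real.exp (potential d y / 4) ≤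
      8 * ((x : ℝ) ^ (1 - alpha d) * Real.exp (potential d x / 4)) := by
  have hα := half_le_alpha hd
  have hα1 := alpha_lt_one (d := d) (by omega)
  have hx0 : 0 < (x : ℝ) := by exact_mod_cast hx
  have hpt : ∀ y ∈ Finset.range x, Real.exp (potential d y / 4) ≤
      8 * (x : ℝ) ^ (1 - alpha d) *
        (Real.exp (potential d (y + 1) / 4) - Real.exp (potential d y / 4)) := by
    intro y hy
    have hyx : ((y + 1 : ℕ) : ℝ) ≤ x := by exact_mod_cast Finset.mem_range.1 hy
    have h1 := mul_rpow_le_potential_sub (d := d) (by omega) y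
    have h2 : (x : ℝ) ^ (alpha d - 1) ≤ ((y + 1 : ℕ) : ℝ) ^ (alpha d - 1) :=
      Real.rpow_le_rpow_of_nonpos (by positivity) hyx (by linarith)
    have h3 : (x : ℝ) ^ (1 - alpha d) * (x : ℝ) ^ (alpha d - 1) = 1 := by
      rw [← Real.rpow_add hx0]
      simp
    have h4 : Real.exp (potential d (y + 1) / 4) = Real.exp (potential d y / 4) *
        Real.exp ((potential d (y + 1) - potential d y) / 4) := by
      rw [← Real.exp_add]
      congr 1
      ring
    have h5 := Real.add_one_le_exp ((potential d (y + 1) - potential d y) / 4)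
    have h6 : (x : ℝ) ^ (alpha d - 1) / 8 ≤
        Real.exp ((potential d (y + 1) - potential d y) / 4) - 1 := by
      have : 0 ≤ ((y + 1 : ℕ) : ℝ) ^ (alpha d - 1) := by positivity
      nlinarith
    have hX : 0 < (x : ℝ) ^ (1 - alpha d) := by positivity
    have h7 : 1 ≤ 8 * (x : ℝ) ^ (1 - alpha d) *
        (Real.exp ((potential d (y + 1) - potential d y) / 4) - 1) := by
      have := mul_le_mul_of_nonneg_left h6 (by positivity : 0 ≤ 8 * (x : ℝ) ^ (1 - alpha d))
      linarith
    rw [h4]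
    have := mul_le_mul_of_nonneg_left h7 (Real.exp_pos (potential d y / 4)).le
    linarith
  refine (Finset.sum_le_sum hpt).trans ?_
  rw [← Finset.mul_sum, Finset.sum_range_sub (fun y => Real.exp (potential d y / 4)), ← mul_assoc]
  refine mul_le_mul_of_nonneg_left ?_ (by positivity)
  linarith [Real.exp_pos (potential d 0 / 4)]

/-- The function with `u 0 = 1` whose flux `w ∇u` is `exp (-x ^ α / 2)`. -/
def supersolution (d x : ℕ) : ℝ :=
  1 + ∑ y ∈ Finset.range x, Real.exp (-potential d y / 2) / conductance d y

theorem supersolution_pos (d x : ℕ) : 0 < supersolution d x := by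
  have : 0 ≤ ∑ y ∈ Finset.range x, Real.exp (-potential d y / 2) / conductance d y :=
    Finset.sum_nonneg fun y _ => div_nonneg (Real.exp_pos _).le (conductance_pos d y).le
  unfold supersolution
  linarith

theorem flux_supersolution (d x : ℕ) :
    conductance d x * (supersolution d (x + 1) - supersolution d x) =
      Real.exp (-potential d x / 2) := by
  unfold supersolution
  rw [Finset.sum_range_succ]
  have := (conductance_pos d x).ne'
  field_simp
  ring

theorem supersolution_le {d : ℕ} (hd : 2 ≤ d) {x : ℕ} (hx : 0 < x) :
    supersolution d x ≤ 36 * ((x : ℝ) ^ (1 - 2 * alpha d) * Real.exp (potential d x / 2)) := by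
  have hα := half_le_alpha hd
  have hα1 := alpha_lt_one (d := d) (by omega)
  have hx0 : 0 < (x : ℝ) := by exact_mod_cast hx
  have hx1 : 1 ≤ (x : ℝ) := by exact_mod_cast hx
  have hP : potential d x = (x : ℝ) ^ alpha d := potential_of_pos d hx
  have hP1 : 1 ≤ potential d x := by rw [hP]; exact Real.one_le_rpow hx1 (by linarith)
  -- `1 + s ≤ 4 exp (s / 4)` absorbs the ratio `(x / y) ^ α ≤ 1 + (x ^ α - y ^ α)`
  have hpt : ∀ y ∈ Finset.range x,
      potential d x * (Real.exp (-potential d y / 2) / conductance d y) ≤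
        4 * Real.exp (potential d x / 4) * Real.exp (potential d y / 4) := by
    intro y hy
    have hyx := Finset.mem_range.1 hy
    have hle : potential d y ≤ potential d x := potential_mono (by omega) hyx.le
    rcases Nat.eq_zero_or_pos y with rfl | hy0
    · simp only [potential_zero, conductance_zero]
      have := Real.add_one_le_exp (potential d x / 4)
      simp
      linarith
    · have hPy : potential d y = (y : ℝ) ^ alpha d := potential_of_pos d hy0
      have hy1 : 1 ≤ potential d y := by
        rw [hPy]
        exact Real.one_le_rpow (by exact_mod_cast hy0) (by linarith)
      have hc : conductance d y = potential d y * Real.exp (-potential d y) := by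
        rw [conductance, if_neg hy0.ne', ← hPy]
      have e1 : potential d x * (Real.exp (-potential d y / 2) / conductance d y) =
          potential d x / potential d y * Real.exp (potential d y / 2) := by
        rw [hc, show potential d y / 2 = -potential d y / 2 - -potential d y by ring, Real.exp_sub]
        field_simp
      have h1 : potential d x / potential d y ≤ 1 + (potential d x - potential d y) := by
        rw [div_le_iff₀ (by linarith)]
        nlinarith
      have h2 := Real.add_one_le_exp ((potential d x - potential d y) / 4)
      have h3 : potential d x / potential d y ≤
          4 * Real.exp ((potential d x - potential d y) / 4) := by linarith
      rw [e1]
      refine (mul_le_mul_of_nonneg_right h3 (Real.exp_pos _).le).trans_eq ?_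
      rw [mul_assoc, mul_assoc, ← Real.exp_add, ← Real.exp_add]
      ring_nf
  have hsum : potential d x * ∑ y ∈ Finset.range x, Real.exp (-potential d y / 2) / conductance d y
      ≤ 32 * ((x : ℝ) ^ (1 - alpha d) * Real.exp (potential d x / 2)) := by
    rw [Finset.mul_sum]
    refine (Finset.sum_le_sum hpt).trans ?_
    rw [← Finset.mul_sum]
    refine (mul_le_mul_of_nonneg_left (sum_exp_potential_le hd x hx) (by positivity)).trans_eq ?_
    rw [show potential d x / 2 = potential d x / 4 + potential d x / 4 by ring, Real.exp_add]
    ring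
  have h1 : potential d x ≤ 2 * ((x : ℝ) ^ (1 - alpha d) * Real.exp (potential d x / 2)) := by
    have e1 := Real.add_one_le_exp (potential d x / 2)
    have e2 : 1 ≤ (x : ℝ) ^ (1 - alpha d) := Real.one_le_rpow hx1 (by linarith)
    have := le_mul_of_one_le_left (Real.exp_pos (potential d x / 2)).le e2
    linarith
  have h2 : potential d x * supersolution d x ≤
      36 * ((x : ℝ) ^ (1 - alpha d) * Real.exp (potential d x / 2)) := by
    have : 0 < (x : ℝ) ^ (1 - alpha d) * Real.exp (potential d x / 2) := by positivity
    rw [supersolution, mul_add, mul_one]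
    linarith
  have h3 : (x : ℝ) ^ (1 - alpha d) = potential d x * (x : ℝ) ^ (1 - 2 * alpha d) := by
    rw [hP, ← Real.rpow_add hx0]
    ring_nf
  rw [h3] at h2
  refine le_of_mul_le_mul_left ?_ (by linarith : 0 < potential d x)
  linarith

/-- The weighted Hardy inequality of the chain for `d ≥ 2`; the weight `x ^ (3 α - 2)` is the one
for which the constant does not depend on `n`. -/
theorem hardy_chain {d : ℕ} (hd : 2 ≤ d) (n : ℕ) {g : ℕ → ℝ} (hg : g 0 = 0) :
    ∑ x ∈ Finset.range n, ((x + 1 : ℕ) : ℝ) ^ (3 * alpha d - 2) *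
        Real.exp (-potential d (x + 1)) * g (x + 1) ^ 2 ≤
      144 * ∑ x ∈ Finset.range n, conductance d x * (g (x + 1) - g x) ^ 2 := by
  have hα := half_le_alpha hd
  have h := hardy_of_supersolution (w := conductance d) (u := supersolution d)
    (fun x => (conductance_pos d x).le) (supersolution_pos d) hg n
  have hrem : 0 ≤ conductance d n * (supersolution d (n + 1) - supersolution d n) *
      (g n ^ 2 / supersolution d n) := by
    rw [flux_supersolution]
    have := supersolution_pos d n
    positivity
  rw [← div_le_iff₀' (by norm_num), Finset.sum_div]
  refine le_trans ?_ ((le_add_of_nonneg_right hrem).trans h)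
  refine Finset.sum_le_sum fun x _ => ?_
  rw [flux_supersolution, flux_supersolution d (x + 1), mul_div_right_comm]
  refine mul_le_mul_of_nonneg_right ?_ (sq_nonneg _)
  have hx0 : 0 < ((x + 1 : ℕ) : ℝ) := by positivity
  set t : ℝ := ((x + 1 : ℕ) : ℝ) with ht
  set P := potential d (x + 1) with hP
  have hu := supersolution_le hd x.succ_pos
  rw [Nat.succ_eq_add_one, ← ht, ← hP] at hu
  have hdrop : t ^ (alpha d - 1) / 4 * Real.exp (-P / 2) ≤
      Real.exp (-potential d x / 2) - Real.exp (-P / 2) := by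
    have h1 := mul_rpow_le_potential_sub (d := d) (by omega) x
    have h2 := Real.add_one_le_exp ((P - potential d x) / 2)
    have h3 : Real.exp (-potential d x / 2) =
        Real.exp ((P - potential d x) / 2) * Real.exp (-P / 2) := by
      rw [← Real.exp_add]
      ring_nf
    have h4 : t ^ (alpha d - 1) / 4 ≤ (P - potential d x) / 2 := by
      have : 0 ≤ t ^ (alpha d - 1) := by positivity
      nlinarith
    rw [h3]
    have := mul_le_mul_of_nonneg_right (h4.trans (by linarith : (P - potential d x) / 2 ≤
      Real.exp ((P - potential d x) / 2) - 1)) (Real.exp_pos (-P / 2)).le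
    linarith
  rw [le_div_iff₀ (supersolution_pos d _)]
  refine le_trans (mul_le_mul_of_nonneg_left hu (by positivity)) (le_trans (le_of_eq ?_) hdrop)
  have e1 : t ^ (alpha d - 1) = t ^ (3 * alpha d - 2) * t ^ (1 - 2 * alpha d) := by
    rw [← Real.rpow_add hx0]
    ring_nf
  have e2 : Real.exp (-P / 2) = Real.exp (-P) * Real.exp (P / 2) := by
    rw [← Real.exp_add]
    ring_nf
  rw [e1, e2]
  ring

/-! ### Upper bounds -/

/-- Bounds `Z` and `Z ∫ (1 + x ^ α) dμ` uniformly in `n`. -/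
theorem exists_sum_exp_mul_le {d : ℕ} (hd : 2 ≤ d) : ∃ K : ℝ, ∀ n : ℕ,
    ∑ x ∈ Finset.range (n + 1), Real.exp (-potential d x) * (1 + potential d x) ≤ K := by
  have hα := half_le_alpha hd
  have hs : Summable fun x : ℕ => 768 * (1 / ((x + 1 : ℕ) : ℝ) ^ 2) :=
    ((summable_nat_add_iff 1).2 (Real.summable_one_div_nat_pow.2 one_lt_two)).mul_left _
  refine ⟨∑' x : ℕ, 768 * (1 / ((x + 1 : ℕ) : ℝ) ^ 2) + 1, fun n => ?_⟩
  rw [Finset.sum_range_succ']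
  simp only [potential_zero, neg_zero, Real.exp_zero, add_zero, mul_one]
  refine add_le_add ?_ le_rfl
  refine le_trans (Finset.sum_le_sum fun x _ => ?_)
    (hs.sum_le_tsum (Finset.range n) fun x _ => by positivity)
  set P := potential d (x + 1) with hP
  have hP0 : 0 ≤ P := potential_nonneg _ _
  set t : ℝ := ((x + 1 : ℕ) : ℝ) with ht
  have ht1 : 1 ≤ t := by rw [ht]; push_cast; linarith [(Nat.cast_nonneg x : (0 : ℝ) ≤ x)]
  have h4 : t ^ 2 ≤ P ^ 4 := by
    rw [hP, potential_succ, ← ht, ← Real.rpow_natCast (t ^ alpha d), ← Real.rpow_mul (by linarith),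
      ← Real.rpow_natCast t]
    refine Real.rpow_le_rpow_of_exponent_le ht1 ?_
    push_cast
    linarith
  have h1 : 1 + P ≤ 2 * Real.exp (P / 2) := by linarith [Real.add_one_le_exp (P / 2)]
  have h2 := Real.pow_div_factorial_le_exp (P / 2) (by linarith) 4
  have h3 : P ^ 4 ≤ 384 * Real.exp (P / 2) := by
    norm_num [Nat.factorial] at h2
    linarith
  have e1 : Real.exp (-P) * (Real.exp (P / 2) * Real.exp (P / 2)) = 1 := by
    rw [← Real.exp_add, ← Real.exp_add]
    simp
  rw [mul_one_div, le_div_iff₀ (by positivity)]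
  calc Real.exp (-P) * (1 + P) * t ^ 2
      ≤ Real.exp (-P) * (2 * Real.exp (P / 2)) * (384 * Real.exp (P / 2)) := by
        gcongr
        exact h4.trans h3
    _ = 768 := by linear_combination 768 * e1

/-- Centring at the left end point: the Hardy inequality bounds the gap by the energy. -/
theorem exists_beckner {d : ℕ} (hd : 2 ≤ d) : ∃ K : ℝ, 0 < K ∧ ∀ (n : ℕ) (a B : ℝ), 0 < a → a ≤ 1 →
    (∀ x : ℕ, 1 ≤ x → x ≤ n → (x : ℝ) ^ (2 - 3 * alpha d + alpha d * a) ≤ B) → 0 ≤ B →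
    Beckner d n a (K * B) := by
  obtain ⟨K₁, hK₁⟩ := exists_sum_exp_mul_le hd
  have hα := half_le_alpha hd
  have hZ : ∀ n, partitionFunction d n ≤ K₁ := fun n => by
    refine le_trans (Finset.sum_le_sum fun x _ => ?_) (hK₁ n)
    exact le_mul_of_one_le_right (Real.exp_pos _).le (by linarith [potential_nonneg d x])
  have hK₁1 : 1 ≤ K₁ := (one_le_partitionFunction d 0).trans (hZ 0)
  set K₂ := 1 + Real.log K₁ with hK₂
  have hK₂1 : 1 ≤ K₂ := by linarith [Real.log_nonneg hK₁1]
  refine ⟨4 * (1 + K₂ * K₁) * (2 * K₂ * 144), by positivity, fun n a B ha0 ha1 hB hB0 => ?_⟩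
  have hbase : ∀ x, 1 - Real.log (mu d n x) ≤ K₂ * (1 + potential d x) := fun x => by
    have h1 : Real.log (mu d n x) = -potential d x - Real.log (partitionFunction d n) := by
      rw [mu, Real.log_div (Real.exp_pos _).ne' (partitionFunction_pos d n).ne', Real.log_exp]
    have h2 := Real.log_le_log (partitionFunction_pos d n) (hZ n)
    have h3 := mul_nonneg (Real.log_nonneg hK₁1) (potential_nonneg d x)
    rw [h1, hK₂]
    linarith
  have hbase1 : ∀ x, x ∈ Finset.range (n + 1) → 1 ≤ 1 - Real.log (mu d n x) := fun x hx => by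
    have : mu d n x ≤ 1 := by
      rw [← sum_mu d n]
      exact Finset.single_le_sum (fun y _ => (mu_pos d n y).le) hx
    linarith [Real.log_nonpos (mu_pos d n x).le this]
  intro f p hp
  have hε : 0 < 2 - p := by linarith [hp.2]
  have hE : 0 < (2 - p) ^ a := Real.rpow_pos_of_pos hε _
  rw [div_le_iff₀ hE]
  have hM : ∑ x ∈ Finset.range (n + 1), mu d n x * (1 - Real.log (mu d n x)) ^ a ≤ K₂ * K₁ := by
    calc ∑ x ∈ Finset.range (n + 1), mu d n x * (1 - Real.log (mu d n x)) ^ a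
        ≤ ∑ x ∈ Finset.range (n + 1),
            K₂ * (Real.exp (-potential d x) * (1 + potential d x)) := by
          refine Finset.sum_le_sum fun x hx => ?_
          have h1 : (1 - Real.log (mu d n x)) ^ a ≤ K₂ * (1 + potential d x) := by
            refine le_trans ?_ (hbase x)
            conv_rhs => rw [← Real.rpow_one (1 - Real.log (mu d n x))]
            exact Real.rpow_le_rpow_of_exponent_le (hbase1 x hx) ha1
          have h2 : mu d n x ≤ Real.exp (-potential d x) :=
            div_le_self (Real.exp_pos _).le (one_le_partitionFunction d n)
          have h3 := potential_nonneg d x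
          calc mu d n x * (1 - Real.log (mu d n x)) ^ a
              ≤ Real.exp (-potential d x) * (K₂ * (1 + potential d x)) :=
                mul_le_mul h2 h1 (Real.rpow_nonneg (by linarith [hbase1 x hx]) _)
                  (Real.exp_pos _).le
            _ = _ := by ring
      _ ≤ K₂ * K₁ := by
          rw [← Finset.mul_sum]
          exact mul_le_mul_of_nonneg_left (hK₁ n) (by linarith)
  have hT : ∑ x ∈ Finset.range (n + 1),
      mu d n x * ((f x - f 0) ^ 2 * (1 - Real.log (mu d n x)) ^ a) ≤
        2 * K₂ * 144 * B * energy d n f := by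
    rw [Finset.sum_range_succ']
    simp only [sub_self, ne_eq, OfNat.ofNat_ne_zero, not_false_eq_true, zero_pow, zero_mul,
      mul_zero, add_zero]
    have hH := hardy_chain hd n (g := fun x => f x - f 0) (sub_self _)
    simp only [sub_sub_sub_cancel_right] at hH
    rw [energy_eq]
    have hZ0 := partitionFunction_pos d n
    calc ∑ x ∈ Finset.range n,
          mu d n (x + 1) * ((f (x + 1) - f 0) ^ 2 * (1 - Real.log (mu d n (x + 1))) ^ a)
        ≤ ∑ x ∈ Finset.range n, 2 * K₂ * B / partitionFunction d n *
            (((x + 1 : ℕ) : ℝ) ^ (3 * alpha d - 2) * Real.exp (-potential d (x + 1)) *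
              (f (x + 1) - f 0) ^ 2) := by
          refine Finset.sum_le_sum fun x hx => ?_
          have hxn := Finset.mem_range.1 hx
          set t : ℝ := ((x + 1 : ℕ) : ℝ) with ht
          have ht0 : 0 < t := by positivity
          have ht1 : 1 ≤ t := by rw [ht]; exact_mod_cast x.succ_pos
          have hV : (1 - Real.log (mu d n (x + 1))) ^ a ≤
              2 * K₂ * (t ^ (3 * alpha d - 2) * B) := by
            have h1 : 1 - Real.log (mu d n (x + 1)) ≤ 2 * K₂ * t ^ alpha d := by
              refine (hbase (x + 1)).trans ?_
              rw [potential_succ, ← ht]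
              have := Real.one_le_rpow ht1 (by linarith : 0 ≤ alpha d)
              nlinarith
            have h2 : (2 * K₂) ^ a ≤ 2 * K₂ := by
              conv_rhs => rw [← Real.rpow_one (2 * K₂)]
              exact Real.rpow_le_rpow_of_exponent_le (by linarith) ha1
            have h3 : (t ^ alpha d) ^ a =
                t ^ (3 * alpha d - 2) * t ^ (2 - 3 * alpha d + alpha d * a) := by
              rw [← Real.rpow_mul ht0.le, ← Real.rpow_add ht0]
              ring_nf
            have h0 : 0 ≤ 1 - Real.log (mu d n (x + 1)) := by
              linarith [hbase1 (x + 1) (Finset.mem_range.2 (by omega))]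
            calc (1 - Real.log (mu d n (x + 1))) ^ a ≤ (2 * K₂ * t ^ alpha d) ^ a :=
                  Real.rpow_le_rpow h0 h1 ha0.le
              _ = (2 * K₂) ^ a * (t ^ alpha d) ^ a :=
                  Real.mul_rpow (by positivity) (by positivity)
              _ ≤ 2 * K₂ * (t ^ (3 * alpha d - 2) * B) := by
                  rw [h3]
                  refine mul_le_mul h2 ?_ (by positivity) (by positivity)
                  exact mul_le_mul_of_nonneg_left (hB (x + 1) (by omega) (by omega))
                    (by positivity)
          calc mu d n (x + 1) * ((f (x + 1) - f 0) ^ 2 * (1 - Real.log (mu d n (x + 1))) ^ a)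
              ≤ mu d n (x + 1) *
                  ((f (x + 1) - f 0) ^ 2 * (2 * K₂ * (t ^ (3 * alpha d - 2) * B))) :=
                mul_le_mul_of_nonneg_left (mul_le_mul_of_nonneg_left hV (sq_nonneg _))
                  (mu_pos d n _).le
            _ = _ := by
                rw [mu]
                ring
      _ ≤ 2 * K₂ * B / partitionFunction d n *
            (144 * ∑ x ∈ Finset.range n, conductance d x * (f (x + 1) - f x) ^ 2) := by
          rw [← Finset.mul_sum]
          exact mul_le_mul_of_nonneg_left hH (by positivity)
      _ = _ := by ring
  have hgap := becknerGap_le_centred (s := Finset.range (n + 1)) (μ := mu d n)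
    (fun x _ => mu_pos d n x) (sum_mu d n) hp ha0 ha1 f (f 0)
  have hen := energy_nonneg d n f
  refine hgap.trans ?_
  calc 4 * (1 + ∑ x ∈ Finset.range (n + 1), mu d n x * (1 - Real.log (mu d n x)) ^ a) *
          (2 - p) ^ a * ∑ x ∈ Finset.range (n + 1),
            mu d n x * ((f x - f 0) ^ 2 * (1 - Real.log (mu d n x)) ^ a)
      ≤ 4 * (1 + K₂ * K₁) * (2 - p) ^ a * (2 * K₂ * 144 * B * energy d n f) := by
        refine mul_le_mul (by gcongr) hT (Finset.sum_nonneg fun x hx => ?_) (by positivity)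
        exact mul_nonneg (mu_pos d n x).le (mul_nonneg (sq_nonneg _)
          (Real.rpow_nonneg (by linarith [hbase1 x hx]) _))
    _ = _ := by ring

theorem poincare_of_three_le {d : ℕ} (hd : 3 ≤ d) (n : ℕ) : Poincare d n 144 := by
  intro f
  have hα : 0 ≤ 3 * alpha d - 2 := by
    have : (3 : ℝ) ≤ d := by exact_mod_cast hd
    have h2 : 2 / 3 ≤ alpha d := by
      unfold alpha
      rw [div_le_div_iff₀ (by norm_num) (by linarith)]
      linarith
    linarith
  have h1 : mean d n (fun x => f x ^ 2) - mean d n f ^ 2 ≤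
      ∑ x ∈ Finset.range (n + 1), mu d n x * (f x - f 0) ^ 2 := by
    have e : ∑ x ∈ Finset.range (n + 1), mu d n x * (f x - f 0) ^ 2 =
        mean d n (fun x => f x ^ 2) - 2 * f 0 * mean d n f + f 0 ^ 2 := by
      have : ∀ x ∈ Finset.range (n + 1), mu d n x * (f x - f 0) ^ 2 =
          mu d n x * f x ^ 2 - 2 * f 0 * (mu d n x * f x) + mu d n x * f 0 ^ 2 :=
        fun x _ => by ring
      rw [Finset.sum_congr rfl this, Finset.sum_add_distrib, Finset.sum_sub_distrib,
        ← Finset.mul_sum, ← Finset.sum_mul, sum_mu, one_mul]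
      rfl
    rw [e]
    nlinarith [sq_nonneg (mean d n f - f 0)]
  refine h1.trans ?_
  rw [Finset.sum_range_succ']
  simp only [sub_self, ne_eq, OfNat.ofNat_ne_zero, not_false_eq_true, zero_pow, mul_zero, add_zero]
  have hH := hardy_chain (by omega : 2 ≤ d) n (g := fun x => f x - f 0) (sub_self _)
  simp only [sub_sub_sub_cancel_right] at hH
  have hZ0 := partitionFunction_pos d n
  rw [energy_eq, ← mul_div_assoc, le_div_iff₀ hZ0, Finset.sum_mul]
  refine le_trans (Finset.sum_le_sum fun x _ => ?_) hH
  have ht : (1 : ℝ) ≤ ((x + 1 : ℕ) : ℝ) := by exact_mod_cast x.succ_pos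
  have h2 := Real.one_le_rpow ht hα
  have e : mu d n (x + 1) * (f (x + 1) - f 0) ^ 2 * partitionFunction d n =
      Real.exp (-potential d (x + 1)) * (f (x + 1) - f 0) ^ 2 := by
    rw [mu]
    field_simp
  rw [e, mul_assoc]
  exact le_mul_of_one_le_left (by positivity) h2

/-- For `d = 1` the measure is comparable to the uniform one, and the oscillation of `f` is
controlled by the energy. -/
theorem beckner_one {n : ℕ} (hn : 1 ≤ n) {a : ℝ} (ha1 : a ≤ 1) :
    Beckner 1 n a (8 * Real.exp 1 * (n : ℝ) ^ 2) := by
  intro f p hp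
  have hε : 0 < 2 - p := by linarith [hp.2]
  have hε1 : 2 - p ≤ 1 := by linarith [hp.1]
  have hE : 0 < (2 - p) ^ a := Real.rpow_pos_of_pos hε _
  have hn1 : (1 : ℝ) ≤ n := by exact_mod_cast hn
  have hα : alpha 1 = 0 := by simp [alpha]
  have hen := energy_nonneg 1 n f
  have hZ : partitionFunction 1 n ≤ 2 * n := by
    have : partitionFunction 1 n ≤ ∑ x ∈ Finset.range (n + 1), (1 : ℝ) :=
      Finset.sum_le_sum fun x _ => Real.exp_le_one_iff.2 (by linarith [potential_nonneg 1 x])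
    simp at this
    linarith
  have hc : ∀ x, 1 ≤ Real.exp 1 * conductance 1 x := fun x => by
    cases x with
    | zero => simp
    | succ x => simp [conductance, hα, ← Real.exp_add]
  set S := ∑ x ∈ Finset.range n, (f (x + 1) - f x) ^ 2 with hS
  have hSE : S ≤ Real.exp 1 * (partitionFunction 1 n * energy 1 n f) := by
    rw [energy_eq, mul_div_cancel₀ _ (partitionFunction_pos 1 n).ne', Finset.mul_sum]
    refine Finset.sum_le_sum fun x _ => ?_
    rw [← mul_assoc]
    exact le_mul_of_one_le_left (sq_nonneg _) (hc x)
  have hosc : ∀ x ∈ Finset.range (n + 1), |f x - f 0| ≤ Real.sqrt (n * S) := fun x hx => by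
    have hxn : x ≤ n := Nat.lt_succ_iff.1 (Finset.mem_range.1 hx)
    refine Real.abs_le_sqrt ?_
    rw [← Finset.sum_range_sub f x]
    refine (sq_sum_le_card_mul_sum_sq).trans ?_
    rw [Finset.card_range]
    refine mul_le_mul (by exact_mod_cast hxn) ?_ (Finset.sum_nonneg fun _ _ => sq_nonneg _)
      (by linarith)
    exact Finset.sum_le_sum_of_subset_of_nonneg (Finset.range_mono hxn) fun _ _ _ => sq_nonneg _
  have hS0 : 0 ≤ S := Finset.sum_nonneg fun _ _ => sq_nonneg _
  have hgap := becknerGap_le_of_abs_sub_le (s := Finset.range (n + 1)) (μ := mu 1 n)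
    (fun x _ => (mu_pos 1 n x).le) (sum_mu 1 n) hp f hosc
  rw [Real.sq_sqrt (by positivity)] at hgap
  rw [div_le_iff₀ hE]
  refine hgap.trans ?_
  have h1 : 2 - p ≤ (2 - p) ^ a := Real.self_le_rpow_of_le_one hε.le hε1 ha1
  have h2 : (n : ℝ) * S ≤ 2 * Real.exp 1 * n ^ 2 * energy 1 n f := by
    calc (n : ℝ) * S ≤ n * (Real.exp 1 * (2 * n * energy 1 n f)) := by
          refine mul_le_mul_of_nonneg_left (hSE.trans ?_) (by linarith)
          gcongr
      _ = _ := by ring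
  calc 4 * (2 - p) * (n * S) ≤ 4 * (2 - p) ^ a * (2 * Real.exp 1 * n ^ 2 * energy 1 n f) := by
        gcongr
    _ = _ := by ring

/-! ### Functionals of functions with small support -/

section Support

variable {ι : Type*} {s A : Finset ι} {μ f : ι → ℝ}

/-- Hölder's inequality on the support `A` of `f`. -/
theorem mul_one_sub_rpow_le_becknerGap (hμ : ∀ x, 0 ≤ μ x) (hA : A ⊆ s)
    (hf : ∀ x ∈ s, x ∉ A → f x = 0) {p : ℝ} (hp : p ∈ Set.Ioo (1 : ℝ) 2) :
    (∑ x ∈ s, μ x * f x ^ 2) * (1 - (∑ x ∈ A, μ x) ^ ((2 - p) / p)) ≤ becknerGap s μ p f := by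
  obtain ⟨hp1, hp2⟩ := hp
  have hp0 : 0 < p := by linarith
  have e1 : ∑ x ∈ s, μ x * |f x| ^ p = ∑ x ∈ A, μ x * |f x| ^ p :=
    (Finset.sum_subset hA fun x hx hxA => by
      rw [hf x hx hxA, abs_zero, Real.zero_rpow hp0.ne', mul_zero]).symm
  have e2 : ∑ x ∈ s, μ x * f x ^ 2 = ∑ x ∈ A, μ x * f x ^ 2 :=
    (Finset.sum_subset hA fun x hx hxA => by rw [hf x hx hxA]; ring).symm
  have h := Real.inner_le_weight_mul_Lp_of_nonneg A (p := 2 / p)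
    (by rw [le_div_iff₀ hp0]; linarith) μ (fun x => |f x| ^ p) hμ (fun x => by positivity)
  have e3 : ∀ x, (|f x| ^ p) ^ (2 / p) = f x ^ 2 := fun x => by
    rw [← Real.rpow_mul (abs_nonneg _), mul_div_cancel₀ _ hp0.ne', Real.rpow_two, sq_abs]
  simp only [e3] at h
  have hA0 : 0 ≤ ∑ x ∈ A, μ x := Finset.sum_nonneg fun x _ => hμ x
  have hQ0 : 0 ≤ ∑ x ∈ A, μ x * f x ^ 2 :=
    Finset.sum_nonneg fun x _ => mul_nonneg (hμ x) (sq_nonneg _)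
  have h2 := Real.rpow_le_rpow
    (Finset.sum_nonneg fun x _ => mul_nonneg (hμ x) (by positivity)) h
    (by positivity : 0 ≤ 2 / p)
  rw [Real.mul_rpow (by positivity) (by positivity), ← Real.rpow_mul hA0, ← Real.rpow_mul hQ0,
    inv_mul_cancel₀ (by positivity), Real.rpow_one,
    show (1 - (2 / p)⁻¹) * (2 / p) = (2 - p) / p by field_simp] at h2
  unfold becknerGap
  rw [e1, e2]
  linarith

theorem sq_sum_le_of_support (hμ : ∀ x, 0 ≤ μ x) (hA : A ⊆ s) (hf : ∀ x ∈ s, x ∉ A → f x = 0) :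
    (∑ x ∈ s, μ x * f x) ^ 2 ≤ (∑ x ∈ A, μ x) * ∑ x ∈ s, μ x * f x ^ 2 := by
  have e1 : ∑ x ∈ s, μ x * f x = ∑ x ∈ A, μ x * f x :=
    (Finset.sum_subset hA fun x hx hxA => by rw [hf x hx hxA, mul_zero]).symm
  have e2 : ∑ x ∈ s, μ x * f x ^ 2 = ∑ x ∈ A, μ x * f x ^ 2 :=
    (Finset.sum_subset hA fun x hx hxA => by rw [hf x hx hxA]; ring).symm
  rw [e1, e2]
  exact Finset.sum_sq_le_sum_mul_sum_of_sq_le_mul A (fun x _ => hμ x)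
    (fun x _ => mul_nonneg (hμ x) (sq_nonneg _)) fun x _ => by
      rw [mul_pow, sq (μ x), mul_assoc]

/-- Jensen's inequality on the support `A` of `f`. -/
theorem mul_neg_log_le_entropy (hμ : ∀ x, 0 ≤ μ x) (hA : A ⊆ s)
    (hf : ∀ x ∈ s, x ∉ A → f x = 0) (hμA : 0 < ∑ x ∈ A, μ x)
    (hQ : 0 < ∑ x ∈ s, μ x * f x ^ 2) :
    (∑ x ∈ s, μ x * f x ^ 2) * -Real.log (∑ x ∈ A, μ x) ≤
      ∑ x ∈ s, μ x * (f x ^ 2 * Real.log (f x ^ 2)) -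
        (∑ x ∈ s, μ x * f x ^ 2) * Real.log (∑ x ∈ s, μ x * f x ^ 2) := by
  have e1 : ∑ x ∈ s, μ x * (f x ^ 2 * Real.log (f x ^ 2)) =
      ∑ x ∈ A, μ x * (f x ^ 2 * Real.log (f x ^ 2)) :=
    (Finset.sum_subset hA fun x hx hxA => by rw [hf x hx hxA]; simp).symm
  have e2 : ∑ x ∈ s, μ x * f x ^ 2 = ∑ x ∈ A, μ x * f x ^ 2 :=
    (Finset.sum_subset hA fun x hx hxA => by rw [hf x hx hxA]; ring).symm
  rw [e2] at hQ
  rw [e1, e2]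
  set Q := ∑ x ∈ A, μ x * f x ^ 2 with hQd
  set q := ∑ x ∈ A, μ x with hq
  have hb : 0 < Q / q := div_pos hQ hμA
  -- tangent line of `t log t` at `Q / q`
  have htan : ∀ t : ℝ, 0 ≤ t → t * Real.log (Q / q) + t - Q / q ≤ t * Real.log t := by
    intro t ht
    rcases ht.eq_or_lt with rfl | ht0
    · simp only [zero_mul]
      linarith
    have h := Real.log_le_sub_one_of_pos (div_pos hb ht0)
    rw [Real.log_div hb.ne' ht0.ne'] at h
    have h2 := mul_le_mul_of_nonneg_left h ht
    rw [mul_sub, mul_sub, mul_div_cancel₀ _ ht0.ne'] at h2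
    linarith
  have hsum : ∑ x ∈ A, μ x * (f x ^ 2 * Real.log (Q / q) + f x ^ 2 - Q / q) ≤
      ∑ x ∈ A, μ x * (f x ^ 2 * Real.log (f x ^ 2)) :=
    Finset.sum_le_sum fun x _ => mul_le_mul_of_nonneg_left (htan _ (sq_nonneg _)) (hμ x)
  have e3 : ∑ x ∈ A, μ x * (f x ^ 2 * Real.log (Q / q) + f x ^ 2 - Q / q) =
      Q * Real.log (Q / q) + Q - q * (Q / q) := by
    rw [hQd, hq, Finset.sum_mul, Finset.sum_mul, ← Finset.sum_add_distrib,
      ← Finset.sum_sub_distrib]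
    exact Finset.sum_congr rfl fun x _ => by ring
  rw [e3, mul_div_cancel₀ _ hμA.ne', Real.log_div hQ.ne' hμA.ne'] at hsum
  linarith

end Support

/-! ### The ramp at the upper end of the chain -/

/-- The length of the ramp, about `N / 2`. -/
def rampLength (N : ℕ) : ℕ := (N + 1) / 2

/-- The point of `{0, …, N ^ d}` where the ramp starts. -/
def rampStart (d N : ℕ) : ℕ := N ^ d - rampLength N

/-- The test function `x ↦ (x - rampStart)₊`, written with truncated subtraction. -/
def ramp (d N x : ℕ) : ℝ := ((x - rampStart d N : ℕ) : ℝ)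

/-- The support `(rampStart, N ^ d]` of the ramp. -/
def rampSupport (d N : ℕ) : Finset ℕ := Finset.Ioc (rampStart d N) (N ^ d)

section Ramp

variable {d N : ℕ}

theorem rampStart_add_rampLength (hd : 1 ≤ d) (N : ℕ) :
    rampStart d N + rampLength N = N ^ d := by
  have := Nat.le_self_pow (by omega : d ≠ 0) N
  unfold rampStart rampLength
  omega

theorem three_mul_rampStart (hd : 1 ≤ d) (hN : 2 ≤ N) : N ^ d ≤ 3 * rampStart d N := by
  have := Nat.le_self_pow (by omega : d ≠ 0) N
  unfold rampStart rampLength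
  omega

theorem pow_rpow_alpha (hd : 1 ≤ d) (N : ℕ) :
    ((N ^ d : ℕ) : ℝ) ^ alpha d = (N : ℝ) ^ ((d : ℝ) - 1) := by
  have : (d : ℝ) ≠ 0 := by positivity
  rw [Nat.cast_pow, ← Real.rpow_natCast, ← Real.rpow_mul (Nat.cast_nonneg N)]
  congr 1
  unfold alpha
  field_simp

theorem potential_pow (hd : 1 ≤ d) (hN : 1 ≤ N) :
    potential d (N ^ d) = (N : ℝ) ^ ((d : ℝ) - 1) := by
  rw [potential_of_pos d (by positivity), pow_rpow_alpha hd]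

theorem potential_pow_le (hd : 1 ≤ d) (hN : 1 ≤ N) :
    potential d (N ^ d) ≤ potential d (rampStart d N) + 2 := by
  rcases hN.eq_or_lt with rfl | hN2
  · rw [potential_pow hd le_rfl]
    simp only [Nat.cast_one, Real.one_rpow]
    linarith [potential_nonneg d (rampStart d 1)]
  have h3 := three_mul_rampStart hd hN2
  have hadd := rampStart_add_rampLength hd N
  have hlen : 3 * rampLength N ≤ 2 * N := by unfold rampLength; omega
  set m := rampStart d N with hm
  have hnpos : 0 < N ^ d := by positivity
  have hm0 : 0 < m := by omega
  have hmR : 0 < (m : ℝ) := by exact_mod_cast hm0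
  have hnR : 0 < ((N ^ d : ℕ) : ℝ) := by exact_mod_cast hnpos
  have hmn : (m : ℝ) ≤ ((N ^ d : ℕ) : ℝ) := by exact_mod_cast (by omega : m ≤ N ^ d)
  have hNR : 0 < (N : ℝ) := by exact_mod_cast hN
  rw [potential_of_pos d hnpos, potential_of_pos d hm0]
  -- `(n / m) ^ α ≤ n / m`
  have h1 : ((N ^ d : ℕ) : ℝ) ^ alpha d ≤ (m : ℝ) ^ alpha d * (((N ^ d : ℕ) : ℝ) / m) := by
    have e : ((N ^ d : ℕ) : ℝ) ^ alpha d =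
        (m : ℝ) ^ alpha d * (((N ^ d : ℕ) : ℝ) / m) ^ alpha d := by
      rw [← Real.mul_rpow hmR.le (by positivity), mul_div_cancel₀ _ hmR.ne']
    rw [e]
    refine mul_le_mul_of_nonneg_left ?_ (by positivity)
    conv_rhs => rw [← Real.rpow_one (((N ^ d : ℕ) : ℝ) / m)]
    exact Real.rpow_le_rpow_of_exponent_le (by rwa [one_le_div hmR]) (alpha_lt_one hd).le
  have h2 : (m : ℝ) ^ alpha d ≤ ((N ^ d : ℕ) : ℝ) ^ alpha d :=
    Real.rpow_le_rpow hmR.le hmn (alpha_nonneg hd)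
  have h4 : ((N ^ d : ℕ) : ℝ) ^ alpha d * N = ((N ^ d : ℕ) : ℝ) := by
    rw [pow_rpow_alpha hd]
    nth_rewrite 2 [← Real.rpow_one (N : ℝ)]
    rw [← Real.rpow_add hNR, sub_add_cancel, Real.rpow_natCast, Nat.cast_pow]
  have h5 : ((N ^ d : ℕ) : ℝ) = m + rampLength N := by exact_mod_cast hadd.symm
  have h6 : ((N ^ d : ℕ) : ℝ) ≤ 3 * m := by exact_mod_cast h3
  have h7 : (3 : ℝ) * rampLength N ≤ 2 * N := by exact_mod_cast hlen
  set n : ℝ := ((N ^ d : ℕ) : ℝ) with hn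
  have h8 : (m : ℝ) ^ alpha d * (n / m) = (m : ℝ) ^ alpha d + (m : ℝ) ^ alpha d * (rampLength N / m)
      := by
    rw [h5]
    field_simp
  have h9 : (m : ℝ) ^ alpha d * (rampLength N / m) ≤ 2 := by
    rw [← mul_div_assoc, div_le_iff₀ hmR]
    have : (m : ℝ) ^ alpha d * rampLength N ≤ n ^ alpha d * (2 * N / 3) :=
      mul_le_mul h2 (by linarith) (by positivity) (by positivity)
    nlinarith
  linarith

theorem ramp_eq_zero {x : ℕ} (hx : x ∈ Finset.range (N ^ d + 1)) (hxA : x ∉ rampSupport d N) :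
    ramp d N x = 0 := by
  rw [rampSupport, Finset.mem_Ioc] at hxA
  rw [Finset.mem_range] at hx
  rw [ramp, Nat.sub_eq_zero_of_le (by omega), Nat.cast_zero]

theorem rampSupport_subset : rampSupport d N ⊆ Finset.range (N ^ d + 1) := fun x hx => by
  rw [rampSupport, Finset.mem_Ioc] at hx
  exact Finset.mem_range.2 (by omega)

theorem card_rampSupport (hd : 1 ≤ d) (N : ℕ) : (rampSupport d N).card = rampLength N := by
  have := rampStart_add_rampLength hd N
  rw [rampSupport, Nat.card_Ioc]
  omega

theorem energy_ramp_le (hd : 1 ≤ d) (hN : 1 ≤ N) :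
    partitionFunction d (N ^ d) * energy d (N ^ d) (ramp d N) ≤
      N * (N : ℝ) ^ ((d : ℝ) - 1) * (Real.exp 2 * Real.exp (-potential d (N ^ d))) := by
  have hadd := rampStart_add_rampLength hd N
  have hlen : rampLength N ≤ N := by unfold rampLength; omega
  have hn1 : 1 ≤ N ^ d := Nat.one_le_pow _ _ hN
  rw [energy_eq, mul_div_cancel₀ _ (partitionFunction_pos _ _).ne']
  have hsplit : ∑ x ∈ Finset.range (N ^ d), conductance d x * (ramp d N (x + 1) - ramp d N x) ^ 2 =
      ∑ y ∈ Finset.range (rampLength N), conductance d (rampStart d N + y) := by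
    rw [← hadd, Finset.sum_range_add, Finset.sum_eq_zero, zero_add]
    · refine Finset.sum_congr rfl fun y _ => ?_
      have e : ramp d N (rampStart d N + y + 1) - ramp d N (rampStart d N + y) = 1 := by
        rw [ramp, ramp, show rampStart d N + y + 1 - rampStart d N = y + 1 by omega,
          show rampStart d N + y - rampStart d N = y by omega]
        push_cast
        ring
      rw [e]
      ring
    · intro x hx
      rw [Finset.mem_range] at hx
      rw [ramp, ramp, Nat.sub_eq_zero_of_le (by omega), Nat.sub_eq_zero_of_le (by omega)]
      simp
  rw [hsplit]
  have hpt : ∀ y ∈ Finset.range (rampLength N), conductance d (rampStart d N + y) ≤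
      (N : ℝ) ^ ((d : ℝ) - 1) * (Real.exp 2 * Real.exp (-potential d (N ^ d))) := by
    intro y hy
    rw [Finset.mem_range] at hy
    have hexp : Real.exp (-potential d (rampStart d N + y)) ≤
        Real.exp 2 * Real.exp (-potential d (N ^ d)) := by
      rw [← Real.exp_add, Real.exp_le_exp]
      linarith [potential_pow_le hd hN,
        potential_mono hd (by omega : rampStart d N ≤ rampStart d N + y)]
    refine mul_le_mul ?_ hexp (Real.exp_pos _).le (by positivity)
    rw [← pow_rpow_alpha hd]
    split_ifs with h
    · exact Real.one_le_rpow (by exact_mod_cast hn1) (alpha_nonneg hd)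
    · exact Real.rpow_le_rpow (by positivity)
        (by exact_mod_cast (by omega : rampStart d N + y ≤ N ^ d)) (alpha_nonneg hd)
  refine (Finset.sum_le_card_nsmul _ _ _ hpt).trans ?_
  rw [Finset.card_range, nsmul_eq_mul, mul_assoc]
  refine mul_le_mul_of_nonneg_right (by exact_mod_cast hlen) (by positivity)

theorem cube_le_sum_sq (l : ℕ) : (l : ℝ) ^ 3 / 3 ≤ ∑ y ∈ Finset.range (l + 1), (y : ℝ) ^ 2 := by
  induction l with
  | zero => simp
  | succ l ih =>
    rw [Finset.sum_range_succ]
    push_cast at ih ⊢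
    nlinarith [(Nat.cast_nonneg l : (0 : ℝ) ≤ l)]

theorem le_mean_ramp_sq (hd : 1 ≤ d) (N : ℕ) :
    (N : ℝ) ^ 3 / 24 * Real.exp (-potential d (N ^ d)) ≤
      partitionFunction d (N ^ d) * mean d (N ^ d) (fun x => ramp d N x ^ 2) := by
  have hadd := rampStart_add_rampLength hd N
  have hlen : (N : ℝ) ≤ 2 * rampLength N := by
    exact_mod_cast (by unfold rampLength; omega : N ≤ 2 * rampLength N)
  have hZ := partitionFunction_pos d (N ^ d)
  have e1 : partitionFunction d (N ^ d) * mean d (N ^ d) (fun x => ramp d N x ^ 2) =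
      ∑ x ∈ Finset.range (N ^ d + 1), Real.exp (-potential d x) * ramp d N x ^ 2 := by
    rw [mean, Finset.mul_sum]
    refine Finset.sum_congr rfl fun x _ => ?_
    rw [mu]
    field_simp
  have h1 : ∑ x ∈ Finset.range (N ^ d + 1), Real.exp (-potential d (N ^ d)) * ramp d N x ^ 2 ≤
      ∑ x ∈ Finset.range (N ^ d + 1), Real.exp (-potential d x) * ramp d N x ^ 2 := by
    refine Finset.sum_le_sum fun x hx => mul_le_mul_of_nonneg_right ?_ (sq_nonneg _)
    rw [Finset.mem_range] at hx
    exact Real.exp_le_exp.2 (neg_le_neg (potential_mono hd (by omega)))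
  have h2 : (N : ℝ) ^ 3 / 24 ≤ ∑ x ∈ Finset.range (N ^ d + 1), ramp d N x ^ 2 := by
    rw [show N ^ d + 1 = rampStart d N + (rampLength N + 1) by omega, Finset.sum_range_add]
    have h3 : 0 ≤ ∑ x ∈ Finset.range (rampStart d N), ramp d N x ^ 2 :=
      Finset.sum_nonneg fun _ _ => sq_nonneg _
    have h4 : ∀ y, ramp d N (rampStart d N + y) = y := fun y => by
      rw [ramp, Nat.add_sub_cancel_left]
    simp only [h4]
    have h5 := pow_le_pow_left₀ (Nat.cast_nonneg N) hlen 3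
    have h6 := cube_le_sum_sq (rampLength N)
    nlinarith
  rw [e1]
  refine le_trans ?_ h1
  rw [← Finset.mul_sum, mul_comm]
  exact mul_le_mul_of_nonneg_left h2 (Real.exp_pos _).le

theorem mean_ramp_sq_pos (hd : 1 ≤ d) (hN : 1 ≤ N) :
    0 < mean d (N ^ d) (fun x => ramp d N x ^ 2) := by
  have hNR : 0 < (N : ℝ) := by exact_mod_cast hN
  refine (mul_pos_iff_of_pos_left (partitionFunction_pos d (N ^ d))).1
    (lt_of_lt_of_le ?_ (le_mean_ramp_sq hd N))
  positivity

/-- The Rayleigh quotient of the ramp is at most of order `N ^ (d - 3)`. -/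
theorem le_of_mean_ramp_sq_le (hd : 1 ≤ d) (hN : 1 ≤ N) {C θ : ℝ} (hC : 0 ≤ C)
    (h : θ * mean d (N ^ d) (fun x => ramp d N x ^ 2) ≤ C * energy d (N ^ d) (ramp d N)) :
    θ / (24 * Real.exp 2) * (N : ℝ) ^ (3 - (d : ℝ)) ≤ C := by
  have hNR : 0 < (N : ℝ) := by exact_mod_cast hN
  have hZ := partitionFunction_pos d (N ^ d)
  have hQ := mean_ramp_sq_pos hd hN
  have hE := energy_ramp_le hd hN
  have hM := le_mean_ramp_sq hd N
  set Q := mean d (N ^ d) (fun x => ramp d N x ^ 2)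
  set E := energy d (N ^ d) (ramp d N)
  set Z := partitionFunction d (N ^ d)
  set w := Real.exp (-potential d (N ^ d))
  have hpow : (N : ℝ) ^ 3 = N * (N : ℝ) ^ ((d : ℝ) - 1) * (N : ℝ) ^ (3 - (d : ℝ)) := by
    nth_rewrite 2 [← Real.rpow_one (N : ℝ)]
    rw [← Real.rpow_add hNR, ← Real.rpow_add hNR, ← Real.rpow_natCast]
    congr 1
    push_cast
    ring
  set R := (N : ℝ) ^ (3 - (d : ℝ)) with hR
  have hR0 : 0 < R := Real.rpow_pos_of_pos hNR _
  have h1 : E * R ≤ 24 * Real.exp 2 * Q := by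
    refine le_of_mul_le_mul_left ?_ hZ
    have h2 := mul_le_mul_of_nonneg_right hE hR0.le
    have h3 := mul_le_mul_of_nonneg_left hM (by positivity : 0 ≤ 24 * Real.exp 2)
    rw [hpow] at h3
    linarith
  have h4 : θ * R * Q ≤ 24 * Real.exp 2 * C * Q := by
    have := mul_le_mul_of_nonneg_right h hR0.le
    have := mul_le_mul_of_nonneg_left h1 hC
    linarith
  have h5 := le_of_mul_le_mul_right h4 hQ
  rw [div_mul_eq_mul_div, div_le_iff₀ (by positivity)]
  linarith

/-- The ramp lives on a set of exponentially small measure. -/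
theorem sum_mu_rampSupport_le (hd : 1 ≤ d) (hN : 1 ≤ N) :
    ∑ x ∈ rampSupport d N, mu d (N ^ d) x ≤ Real.exp (-((N : ℝ) ^ ((d : ℝ) - 1) / 4)) := by
  have hadd := rampStart_add_rampLength hd N
  have hcard := card_rampSupport hd N
  have hlen : 2 * rampLength N ≤ N + 1 := by unfold rampLength; omega
  have hlen1 : 1 ≤ rampLength N := by unfold rampLength; omega
  have hZ := partitionFunction_pos d (N ^ d)
  simp only [mu]
  rw [← Finset.sum_div, div_le_iff₀ hZ]
  have hA : ∑ x ∈ rampSupport d N, Real.exp (-potential d x) ≤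
      rampLength N * Real.exp (-potential d (rampStart d N + 1)) := by
    rw [← hcard, ← nsmul_eq_mul]
    refine Finset.sum_le_card_nsmul _ _ _ fun x hx => ?_
    rw [rampSupport, Finset.mem_Ioc] at hx
    exact Real.exp_le_exp.2 (neg_le_neg (potential_mono hd (by omega)))
  refine hA.trans ?_
  rcases hd.eq_or_lt with rfl | hd2
  · have hα : alpha 1 = 0 := by simp [alpha]
    have hZ1 : partitionFunction 1 (N ^ 1) = N * Real.exp (-1) + 1 := by
      rw [partitionFunction, Finset.sum_range_succ']
      simp [hα]
    have h1 : (2 : ℝ) * rampLength N ≤ N + 1 := by exact_mod_cast hlen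
    have h2 := Real.add_one_le_exp (-((N : ℝ) ^ (((1 : ℕ) : ℝ) - 1) / 4))
    simp only [Nat.cast_one, sub_self, Real.rpow_zero] at h2 ⊢
    rw [hZ1, potential_succ, hα, Real.rpow_zero]
    have h3 : Real.exp (-1) ≤ 1 := Real.exp_le_one_iff.2 (by norm_num)
    have h4 := mul_le_mul_of_nonneg_right h1 (Real.exp_pos (-1)).le
    have h5 : 0 ≤ N * Real.exp (-1) + 1 := by positivity
    have h6 := mul_le_mul_of_nonneg_right h2 h5
    linarith
  · have hα := half_le_alpha hd2
    have hα1 := alpha_lt_one hd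
    have hsq : N ^ 2 ≤ N ^ d := Nat.pow_le_pow_right hN hd2
    have h4 : 4 * (rampLength N - 1) ≤ rampStart d N + 1 := by
      have h5 : 5 * rampLength N ≤ N ^ 2 + 5 := by
        zify at hlen ⊢
        nlinarith [sq_nonneg (4 * (N : ℤ) - 5)]
      omega
    have h2 : N ^ d ≤ 2 * (rampStart d N + 1) := by
      have := Nat.le_self_pow (by omega : d ≠ 0) N
      omega
    have hmR : 0 ≤ ((rampStart d N + 1 : ℕ) : ℝ) := Nat.cast_nonneg _
    have hP1 : potential d (rampLength N - 1) ≤ potential d (rampStart d N + 1) / 2 := by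
      rcases Nat.eq_zero_or_pos (rampLength N - 1) with h0 | hpos
      · rw [h0, potential_zero]
        have := potential_nonneg d (rampStart d N + 1)
        positivity
      rw [potential_of_pos d hpos, potential_succ, le_div_iff₀ (by norm_num)]
      have e4 : (2 : ℝ) ≤ 4 ^ alpha d := by
        have : (4 : ℝ) ^ (1 / 2 : ℝ) = 2 := by
          rw [show (4 : ℝ) = 2 ^ (2 : ℝ) by norm_num, ← Real.rpow_mul (by norm_num)]
          norm_num
        rw [← this]
        exact Real.rpow_le_rpow_of_exponent_le (by norm_num) hα
      calc ((rampLength N - 1 : ℕ) : ℝ) ^ alpha d * 2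
          ≤ ((rampLength N - 1 : ℕ) : ℝ) ^ alpha d * 4 ^ alpha d :=
            mul_le_mul_of_nonneg_left e4 (by positivity)
        _ = (((rampLength N - 1 : ℕ) : ℝ) * 4) ^ alpha d :=
            (Real.mul_rpow (by positivity) (by norm_num)).symm
        _ ≤ _ := by
            refine Real.rpow_le_rpow (by positivity) ?_ (by linarith)
            rw [mul_comm]
            exact_mod_cast h4
    have hP2 : (N : ℝ) ^ ((d : ℝ) - 1) ≤ 2 * potential d (rampStart d N + 1) := by
      rw [← pow_rpow_alpha hd, potential_succ]
      calc ((N ^ d : ℕ) : ℝ) ^ alpha d ≤ (2 * ((rampStart d N + 1 : ℕ) : ℝ)) ^ alpha d :=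
            Real.rpow_le_rpow (by positivity) (by exact_mod_cast h2) (by linarith)
        _ = 2 ^ alpha d * ((rampStart d N + 1 : ℕ) : ℝ) ^ alpha d :=
            Real.mul_rpow (by norm_num) hmR
        _ ≤ _ := by
            refine mul_le_mul_of_nonneg_right ?_ (by positivity)
            conv_rhs => rw [← Real.rpow_one (2 : ℝ)]
            exact Real.rpow_le_rpow_of_exponent_le (by norm_num) hα1.le
    -- compare with as many points at the lower end of the chain
    have hlow : rampLength N * Real.exp (-potential d (rampLength N - 1)) ≤
        partitionFunction d (N ^ d) := by
      have h5 : ∑ x ∈ Finset.range (rampLength N), Real.exp (-potential d x) ≤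
          partitionFunction d (N ^ d) :=
        Finset.sum_le_sum_of_subset_of_nonneg (Finset.range_mono (by omega))
          fun _ _ _ => (Real.exp_pos _).le
      refine le_trans ?_ h5
      rw [← nsmul_eq_mul]
      conv_lhs => rw [← Finset.card_range (rampLength N)]
      refine Finset.card_nsmul_le_sum _ _ _ fun x hx => ?_
      rw [Finset.mem_range] at hx
      refine Real.exp_le_exp.2 (neg_le_neg (potential_mono hd ?_))
      rw [Finset.card_range]
      omega
    refine le_trans ?_ (mul_le_mul_of_nonneg_left hlow (Real.exp_pos _).le)
    rw [mul_left_comm, ← Real.exp_add]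
    refine mul_le_mul_of_nonneg_left (Real.exp_le_exp.2 ?_) (by positivity)
    linarith

theorem sum_mu_rampSupport_pos (hd : 1 ≤ d) (hN : 1 ≤ N) :
    0 < ∑ x ∈ rampSupport d N, mu d (N ^ d) x := by
  refine Finset.sum_pos (fun x _ => mu_pos _ _ _) (Finset.card_pos.1 ?_)
  rw [card_rampSupport hd N]
  unfold rampLength
  omega

/-! ### Lower bounds -/

theorem le_of_beckner (hd : 1 ≤ d) (hN : 1 ≤ N) {a C : ℝ} (ha : 0 < a) (hC : 0 ≤ C)
    (h : Beckner d (N ^ d) a C) :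
    (1 - Real.exp (-(1 / 16))) / (24 * Real.exp 2) *
      (N : ℝ) ^ (3 - (d : ℝ) + ((d : ℝ) - 1) * a) ≤ C := by
  have hN1 : (1 : ℝ) ≤ N := by exact_mod_cast hN
  have hd1 : (1 : ℝ) ≤ d := by exact_mod_cast hd
  have hNR : 0 < (N : ℝ) := by linarith
  set T := (N : ℝ) ^ ((d : ℝ) - 1) with hT
  have hT1 : 1 ≤ T := Real.one_le_rpow hN1 (by linarith)
  -- the exponent `p = 2 - ε` for which `μ(A) ^ (ε / p)` stays away from `1`
  set ε := T⁻¹ / 2 with hε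
  have hTinv : T⁻¹ ≤ 1 := inv_le_one_of_one_le₀ hT1
  have hTi0 : 0 < T⁻¹ := by positivity
  have hε0 : 0 < ε := by positivity
  have hp : 2 - ε ∈ Set.Ioo (1 : ℝ) 2 := ⟨by linarith, by linarith⟩
  have h1 := h (ramp d N) (2 - ε) hp
  rw [sub_sub_cancel, div_le_iff₀ (Real.rpow_pos_of_pos hε0 _)] at h1
  have h2 := mul_one_sub_rpow_le_becknerGap (s := Finset.range (N ^ d + 1)) (f := ramp d N)
    (fun x => (mu_pos d (N ^ d) x).le) (rampSupport_subset (d := d) (N := N))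
    (fun x hx hxA => ramp_eq_zero hx hxA) hp
  rw [sub_sub_cancel] at h2
  have h3 := h2.trans h1
  have hQ : ∑ x ∈ Finset.range (N ^ d + 1), mu d (N ^ d) x * ramp d N x ^ 2 =
    mean d (N ^ d) (fun x => ramp d N x ^ 2) := rfl
  rw [hQ] at h3
  have hQ0 := mean_ramp_sq_pos hd hN
  have h4 : (∑ x ∈ rampSupport d N, mu d (N ^ d) x) ^ (ε / (2 - ε)) ≤ Real.exp (-(1 / 16)) := by
    refine (Real.rpow_le_rpow (sum_mu_rampSupport_pos hd hN).le (sum_mu_rampSupport_le hd hN)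
      (div_nonneg hε0.le (by linarith))).trans ?_
    rw [← hT, ← Real.exp_mul, Real.exp_le_exp, neg_mul, neg_le_neg_iff]
    have h5 : T * ε = 1 / 2 := by
      rw [hε]
      field_simp
    rw [div_mul_div_comm, h5, div_le_div_iff₀ (by norm_num) (by linarith)]
    linarith
  have h6 : ε ^ a ≤ (T ^ a)⁻¹ := by
    rw [← Real.inv_rpow (by positivity)]
    exact Real.rpow_le_rpow hε0.le (by linarith) ha.le
  have hE0 := energy_nonneg d (N ^ d) (ramp d N)
  have hTa : 0 < T ^ a := by positivity
  have h7 : (1 - Real.exp (-(1 / 16))) * T ^ a * mean d (N ^ d) (fun x => ramp d N x ^ 2) ≤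
      C * energy d (N ^ d) (ramp d N) := by
    have h8 := mul_le_mul_of_nonneg_left (sub_le_sub_left h4 1) hQ0.le
    have h9 := mul_le_mul_of_nonneg_left h6 (mul_nonneg hC hE0)
    have h10 := mul_le_mul_of_nonneg_right ((h8.trans h3).trans h9) hTa.le
    rw [mul_assoc (C * _), inv_mul_cancel₀ hTa.ne', mul_one] at h10
    linarith
  have h11 := le_of_mean_ramp_sq_le hd hN hC h7
  refine (le_of_eq ?_).trans h11
  rw [Real.rpow_add hNR, Real.rpow_mul hNR.le, ← hT]
  ring

theorem le_of_poincare (hd : 1 ≤ d) (hN : 1 ≤ N) {C : ℝ} (hC : 0 ≤ C)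
    (h : Poincare d (N ^ d) C) :
    (1 - Real.exp (-(1 / 4))) / (24 * Real.exp 2) * (N : ℝ) ^ (3 - (d : ℝ)) ≤ C := by
  have hN1 : (1 : ℝ) ≤ N := by exact_mod_cast hN
  have hd1 : (1 : ℝ) ≤ d := by exact_mod_cast hd
  have hT1 : 1 ≤ (N : ℝ) ^ ((d : ℝ) - 1) := Real.one_le_rpow hN1 (by linarith)
  refine le_of_mean_ramp_sq_le hd hN hC (le_trans ?_ (h (ramp d N)))
  have h2 := sq_sum_le_of_support (s := Finset.range (N ^ d + 1)) (f := ramp d N)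
    (fun x => (mu_pos d (N ^ d) x).le) (rampSupport_subset (d := d) (N := N))
    (fun x hx hxA => ramp_eq_zero hx hxA)
  have h3 : ∑ x ∈ rampSupport d N, mu d (N ^ d) x ≤ Real.exp (-(1 / 4)) :=
    (sum_mu_rampSupport_le hd hN).trans (Real.exp_le_exp.2 (by linarith))
  have h4 := mul_le_mul_of_nonneg_right h3 (mean_ramp_sq_pos hd hN).le
  have h5 : mean d (N ^ d) (ramp d N) ^ 2 ≤ (∑ x ∈ rampSupport d N, mu d (N ^ d) x) *
    mean d (N ^ d) (fun x => ramp d N x ^ 2) := h2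
  linarith

theorem le_of_logSobolev (hd : 1 ≤ d) (hN : 1 ≤ N) {C : ℝ} (hC : 0 ≤ C)
    (h : LogSobolev d (N ^ d) C) :
    1 / (96 * Real.exp 2) * (N : ℝ) ^ (2 : ℝ) ≤ C := by
  have hN1 : (1 : ℝ) ≤ N := by exact_mod_cast hN
  have hNR : 0 < (N : ℝ) := by linarith
  have h1 : (N : ℝ) ^ ((d : ℝ) - 1) / 4 * mean d (N ^ d) (fun x => ramp d N x ^ 2) ≤
      C * energy d (N ^ d) (ramp d N) := by
    refine le_trans ?_ (h (ramp d N))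
    have hQ0 := mean_ramp_sq_pos hd hN
    have hA0 := sum_mu_rampSupport_pos hd hN
    have h2 := mul_neg_log_le_entropy (s := Finset.range (N ^ d + 1)) (f := ramp d N)
      (fun x => (mu_pos d (N ^ d) x).le) (rampSupport_subset (d := d) (N := N))
      (fun x hx hxA => ramp_eq_zero hx hxA) hA0 hQ0
    refine le_trans ?_ h2
    rw [mul_comm]
    refine mul_le_mul_of_nonneg_left ?_ hQ0.le
    have h3 := Real.log_le_log hA0 (sum_mu_rampSupport_le hd hN)
    rw [Real.log_exp] at h3
    linarith
  refine (le_of_eq ?_).trans (le_of_mean_ramp_sq_le hd hN hC h1)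
  have : (N : ℝ) ^ (2 : ℝ) = (N : ℝ) ^ ((d : ℝ) - 1) * (N : ℝ) ^ (3 - (d : ℝ)) := by
    rw [← Real.rpow_add hNR]
    ring_nf
  rw [this]
  field_simp
  norm_num

end Ramp

/-! ### Growth of the best constants -/

theorem becknerConst_le {d N : ℕ} {a C : ℝ} (hC : 0 ≤ C) (h : Beckner d (N ^ d) a C) :
    becknerConst d a N ≤ ENNReal.ofReal C := by
  refine iInf₂_le (C.toNNReal) ?_
  rwa [Real.coe_toNNReal C hC]

theorem le_becknerConst {d N : ℕ} (hd : 1 ≤ d) (hN : 1 ≤ N) {a : ℝ} (ha : 0 < a) :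
    ENNReal.ofReal ((1 - Real.exp (-(1 / 16))) / (24 * Real.exp 2) *
      (N : ℝ) ^ (3 - (d : ℝ) + ((d : ℝ) - 1) * a)) ≤ becknerConst d a N := by
  refine le_iInf₂ fun C hC => ?_
  rw [← ENNReal.ofReal_coe_nnreal]
  exact ENNReal.ofReal_le_ofReal (le_of_beckner hd hN ha C.2 hC)

theorem le_poincareConst {d N : ℕ} (hd : 1 ≤ d) (hN : 1 ≤ N) :
    ENNReal.ofReal ((1 - Real.exp (-(1 / 4))) / (24 * Real.exp 2) * (N : ℝ) ^ (3 - (d : ℝ))) ≤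
      poincareConst d N := by
  refine le_iInf₂ fun C hC => ?_
  rw [← ENNReal.ofReal_coe_nnreal]
  exact ENNReal.ofReal_le_ofReal (le_of_poincare hd hN C.2 hC)

theorem le_logSobolevConst {d N : ℕ} (hd : 1 ≤ d) (hN : 1 ≤ N) :
    ENNReal.ofReal (1 / (96 * Real.exp 2) * (N : ℝ) ^ (2 : ℝ)) ≤ logSobolevConst d N := by
  refine le_iInf₂ fun C hC => ?_
  rw [← ENNReal.ofReal_coe_nnreal]
  exact ENNReal.ofReal_le_ofReal (le_of_logSobolev hd hN C.2 hC)

theorem blowsUp_of_le {c : ℕ → ℝ≥0∞} {k γ : ℝ} (hk : 0 < k) (hγ : 0 < γ)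
    (h : ∀ N : ℕ, 1 ≤ N → ENNReal.ofReal (k * (N : ℝ) ^ γ) ≤ c N) : BlowsUp c := by
  have h1 : Tendsto (fun N : ℕ => ENNReal.ofReal (k * (N : ℝ) ^ γ)) atTop (𝓝 ⊤) :=
    ENNReal.tendsto_ofReal_atTop.comp
      (((tendsto_rpow_atTop hγ).comp tendsto_natCast_atTop_atTop).const_mul_atTop hk)
  exact tendsto_nhds_top_mono h1 (eventually_atTop.2 ⟨1, h⟩)

theorem mul_exponent_eq {d : ℕ} (hd : 1 ≤ d) (a : ℝ) :
    (d : ℝ) * (2 - 3 * alpha d + alpha d * a) = 3 - (d : ℝ) + ((d : ℝ) - 1) * a := by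
  have : (d : ℝ) ≠ 0 := by positivity
  unfold alpha
  field_simp
  ring

theorem exists_becknerConst_le {d : ℕ} (hd : 1 ≤ d) {a : ℝ} (ha : a ∈ Set.Ioo (0 : ℝ) 1)
    (hγ : 0 ≤ 3 - (d : ℝ) + ((d : ℝ) - 1) * a) : ∃ K : ℝ, 0 < K ∧ ∀ N : ℕ, 1 ≤ N →
    becknerConst d a N ≤ ENNReal.ofReal (K * (N : ℝ) ^ (3 - (d : ℝ) + ((d : ℝ) - 1) * a)) := by
  rcases hd.eq_or_lt with rfl | hd2
  · refine ⟨8 * Real.exp 1, by positivity, fun N hN => becknerConst_le (by positivity) ?_⟩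
    have h := beckner_one (n := N ^ 1) (by simpa using hN) ha.2.le
    have e : (N : ℝ) ^ (3 - ((1 : ℕ) : ℝ) + (((1 : ℕ) : ℝ) - 1) * a) = ((N ^ 1 : ℕ) : ℝ) ^ 2 := by
      rw [pow_one, ← Real.rpow_natCast]
      congr 1
      norm_num
    rwa [e]
  · obtain ⟨K, hK, h⟩ := exists_beckner hd2
    refine ⟨K, hK, fun N hN => becknerConst_le (by positivity)
      (h (N ^ d) a _ ha.1 ha.2.le (fun x hx hxn => ?_) (by positivity))⟩
    have hd0 : 0 < (d : ℝ) := by positivity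
    have he : 0 ≤ 2 - 3 * alpha d + alpha d * a := by
      rw [← mul_exponent_eq hd] at hγ
      exact (mul_nonneg_iff_of_pos_left hd0).1 hγ
    refine (Real.rpow_le_rpow (by positivity) (Nat.cast_le.2 hxn) he).trans_eq ?_
    rw [← mul_exponent_eq hd, Nat.cast_pow, ← Real.rpow_natCast,
      ← Real.rpow_mul (Nat.cast_nonneg N)]

theorem becknerConst_growsLike {d : ℕ} (hd : 1 ≤ d) {a : ℝ} (ha : a ∈ Set.Ioo (0 : ℝ) 1)
    (hγ : 0 < 3 - (d : ℝ) + ((d : ℝ) - 1) * a) :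
    GrowsLike (becknerConst d a) (3 - (d : ℝ) + ((d : ℝ) - 1) * a) := by
  obtain ⟨K, hK, hup⟩ := exists_becknerConst_le hd ha hγ.le
  set κ : ℝ := (1 - Real.exp (-(1 / 16))) / (24 * Real.exp 2) with hκ
  have hκ0 : 0 < κ := by
    have : Real.exp (-(1 / 16)) < 1 := Real.exp_lt_one_iff.2 (by norm_num)
    exact div_pos (by linarith) (by positivity)
  refine ⟨max K κ⁻¹, lt_max_of_lt_left hK, fun N hN => ⟨?_, ?_⟩⟩
  · refine le_trans (ENNReal.ofReal_le_ofReal ?_) (le_becknerConst hd hN ha.1)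
    refine mul_le_mul_of_nonneg_right ?_ (by positivity)
    exact inv_le_of_inv_le₀ hκ0 (le_max_right _ _)
  · refine (hup N hN).trans (ENNReal.ofReal_le_ofReal ?_)
    exact mul_le_mul_of_nonneg_right (le_max_left _ _) (by positivity)

theorem becknerConst_staysBounded {d : ℕ} (hd : 2 ≤ d) {a : ℝ} (ha : a ∈ Set.Ioo (0 : ℝ) 1)
    (hγ : 3 - (d : ℝ) + ((d : ℝ) - 1) * a ≤ 0) : StaysBounded (becknerConst d a) := by
  obtain ⟨K, hK, h⟩ := exists_beckner hd
  refine ⟨(K * 1).toNNReal, fun N _ => becknerConst_le (by positivity)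
    (h (N ^ d) a 1 ha.1 ha.2.le (fun x hx _ => ?_) zero_le_one)⟩
  have hd0 : 0 < (d : ℝ) := by positivity
  refine Real.rpow_le_one_of_one_le_of_nonpos (by exact_mod_cast hx) ?_
  rw [← mul_exponent_eq (by omega)] at hγ
  exact nonpos_of_mul_nonpos_right hγ hd0

theorem poincareConst_staysBounded {d : ℕ} (hd : 3 ≤ d) : StaysBounded (poincareConst d) :=
  ⟨144, fun N _ => iInf₂_le (144 : ℝ≥0) (poincare_of_three_le hd (N ^ d))⟩

theorem poincareConst_blowsUp {d : ℕ} (hd : 1 ≤ d) (hd3 : d < 3) : BlowsUp (poincareConst d) := by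
  have h3 : (d : ℝ) < 3 := by exact_mod_cast hd3
  have : Real.exp (-(1 / 4)) < 1 := Real.exp_lt_one_iff.2 (by norm_num)
  exact blowsUp_of_le (div_pos (by linarith) (by positivity)) (by linarith : 0 < 3 - (d : ℝ))
    fun N hN => le_poincareConst hd hN

theorem logSobolevConst_blowsUp {d : ℕ} (hd : 1 ≤ d) : BlowsUp (logSobolevConst d) :=
  blowsUp_of_le (by positivity) two_pos fun _ hN => le_logSobolevConst hd hN

theorem becknerConst_blowsUp {d : ℕ} (hd : 1 ≤ d) {a : ℝ} (ha : 0 < a)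
    (hγ : 0 < 3 - (d : ℝ) + ((d : ℝ) - 1) * a) : BlowsUp (becknerConst d a) := by
  have : Real.exp (-(1 / 16)) < 1 := Real.exp_lt_one_iff.2 (by norm_num)
  exact blowsUp_of_le (div_pos (by linarith) (by positivity)) hγ
    fun N hN => le_becknerConst hd hN ha

/-- The critical exponent `a_d`. For `d = 1` the Beckner constants grow for every `a`, and any
negative value serves. -/
def criticalExponent (d : ℕ) : ℝ := if d = 1 then -1 else ((d : ℝ) - 3) / ((d : ℝ) - 1)

theorem criticalExponent_of_two_le {d : ℕ} (hd : 2 ≤ d) :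
    criticalExponent d = ((d : ℝ) - 3) / ((d : ℝ) - 1) := if_neg (by omega)

theorem exponent_pos_of_criticalExponent_lt {d : ℕ} (hd : 1 ≤ d) {a : ℝ}
    (h : criticalExponent d < a) : 0 < 3 - (d : ℝ) + ((d : ℝ) - 1) * a := by
  rcases hd.eq_or_lt with rfl | hd2
  · norm_num
  · have : (2 : ℝ) ≤ d := by exact_mod_cast hd2
    rw [criticalExponent_of_two_le hd2, div_lt_iff₀ (by linarith)] at h
    linarith

end ToyModel

end

theorem mainTheorem5 (d : ℕ) (hd : 1 ≤ d) :
    ∃ a_d : ℝ,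
      (2 ≤ d → a_d = (3 * ToyModel.alpha d - 2) / ToyModel.alpha d) ∧
      (∀ a ∈ Set.Ioo (0 : ℝ) 1, a_d < a →
        0 < (d : ℝ) * (2 - 3 * ToyModel.alpha d + ToyModel.alpha d * a) ∧
        ToyModel.GrowsLike (ToyModel.becknerConst d a)
          ((d : ℝ) * (2 - 3 * ToyModel.alpha d + ToyModel.alpha d * a))) ∧
      (∀ a ∈ Set.Ioo (0 : ℝ) 1, a < a_d →
        ToyModel.StaysBounded (ToyModel.becknerConst d a)) ∧
      (d = 1 ∨ d = 2 →
        a_d < 0 ∧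
        ToyModel.BlowsUp (ToyModel.poincareConst d) ∧
        (∀ a ∈ Set.Ioo (0 : ℝ) 1, ToyModel.BlowsUp (ToyModel.becknerConst d a)) ∧
        ToyModel.BlowsUp (ToyModel.logSobolevConst d)) ∧
      (d = 3 →
        a_d = 0 ∧
        ToyModel.StaysBounded (ToyModel.poincareConst d) ∧
        (∀ a ∈ Set.Ioo (0 : ℝ) 1, ToyModel.BlowsUp (ToyModel.becknerConst d a)) ∧
        ToyModel.BlowsUp (ToyModel.logSobolevConst d)) ∧
      (3 < d → a_d ∈ Set.Ioo (0 : ℝ) 1) := by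
  have hblow : ToyModel.criticalExponent d ≤ 0 →
      ∀ a ∈ Set.Ioo (0 : ℝ) 1, ToyModel.BlowsUp (ToyModel.becknerConst d a) := fun h a ha =>
    ToyModel.becknerConst_blowsUp hd ha.1
      (ToyModel.exponent_pos_of_criticalExponent_lt hd (h.trans_lt ha.1))
  refine ⟨ToyModel.criticalExponent d, fun h2 => ?_, fun a ha hlt => ?_, fun a ha hlt => ?_,
    fun h12 => ?_, fun h3 => ?_, fun h3 => ?_⟩
  · have h2R : (2 : ℝ) ≤ d := by exact_mod_cast h2
    have h1 : (d : ℝ) - 1 ≠ 0 := by linarith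
    have h0 : (d : ℝ) ≠ 0 := by linarith
    rw [ToyModel.criticalExponent_of_two_le h2, ToyModel.alpha]
    field_simp
    ring
  · have hγ := ToyModel.exponent_pos_of_criticalExponent_lt hd hlt
    rw [ToyModel.mul_exponent_eq hd]
    exact ⟨hγ, ToyModel.becknerConst_growsLike hd ha hγ⟩
  · have h2 : 2 ≤ d := by
      by_contra hcon
      obtain rfl : d = 1 := by omega
      simp only [ToyModel.criticalExponent, if_true] at hlt
      linarith [ha.1]
    have h2R : (2 : ℝ) ≤ d := by exact_mod_cast h2
    rw [ToyModel.criticalExponent_of_two_le h2, lt_div_iff₀ (by linarith)] at hlt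
    exact ToyModel.becknerConst_staysBounded h2 ha (by linarith)
  · have hneg : ToyModel.criticalExponent d < 0 := by
      rcases h12 with rfl | rfl <;> norm_num [ToyModel.criticalExponent]
    exact ⟨hneg, ToyModel.poincareConst_blowsUp hd (by omega), hblow hneg.le,
      ToyModel.logSobolevConst_blowsUp hd⟩
  · have hzero : ToyModel.criticalExponent d = 0 := by
      subst h3
      norm_num [ToyModel.criticalExponent]
    exact ⟨hzero, ToyModel.poincareConst_staysBounded h3.ge, hblow hzero.le,
      ToyModel.logSobolevConst_blowsUp hd⟩
  · have h3R : (3 : ℝ) < d := by exact_mod_cast h3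
    rw [ToyModel.criticalExponent_of_two_le (by omega)]
    exact ⟨div_pos (by linarith) (by linarith), (div_lt_one (by linarith)).2 (by linarith)⟩
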